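/- For a map $f$ between metric spaces let $\operatorname{Lip}(f)=\sup_{a\ne b}|f(a)-f(b)|/|a-b|\in[0,\infty]$, let $\mathbb{T}$ be the unit circle in $\mathbb{C}$, and call a homeomorphism $F\colon\mathbb{C}\to\mathbb{C}$ an extension of $f\colon\mathbb{T}\to\mathbb{C}$ if $F=f$ on $\mathbb{T}$. For small $\epsilon>0$ let $\Gamma_\epsilon$ be the keyhole-shaped curve that is the union of the circular arcs \[ \sigma_1=\{e^{it}:\epsilon\le t\le 2\pi-\epsilon\},\quad \sigma_2=\{2e^{it}:\epsilon\le t\le \pi-\epsilon\}, \] \[ \sigma_3=\{2e^{it}:\pi+\epsilon\le t\le 2\pi-\epsilon\},\quad \sigma_4=\{3e^{it}:-\pi+\epsilon\le t\le \pi-\epsilon\} \] and of the radial segments $\{re^{\pm i\epsilon}:1\le r\le 2\}$ and $\{re^{i(\pi\pm\epsilon)}:2\le r\le 3\}$. (1) There are absolute constants $\epsilon_0,c,C>0$ such that for every $0<\epsilon<\epsilon_0$ there is an embedding $f\colon\mathbb{T}\to\mathbb{C}$ with $f(\mathbb{T})=\Gamma_\epsilon$, equal to the identity on $\sigma_1$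 and of constant speed on the complementary arc $\{e^{it}:|t|\le\epsilon\}$, such that \[ \operatorname{Lip}(f^{-1})\le 2,\qquad \frac{c}{\epsilon}\le\operatorname{Lip}(f)\le\frac{C}{\epsilon},\qquad \frac{c}{\epsilon}\le \operatorname{Lip}(f)\operatorname{Lip}(f^{-1})^2\le\frac{C}{\epsilon}, \] and every homeomorphism $F\colon\mathbb{C}\to\mathbb{C}$ extending $f$ satisfies \[ \operatorname{Lip}(F^{-1})\ge\frac{2\pi-2\epsilon}{4\epsilon} \qquad\text{and}\qquad \operatorname{Lip}(F^{-1})\ge c\,\operatorname{Lip}(f)\operatorname{Lip}(f^{-1})^2 . \] (With $L=\operatorname{Lip}(f)$ and $\ell=1/\operatorname{Lip}(f^{-1})$, the quantity $\operatorname{Lip}(f)\operatorname{Lip}(f^{-1})^2$ is $L/\ell^2$.) For real $0<\ell\le L$ call $m\in\mathbb{R}$ an admissible lower factor for $(\ell,L)$ if every embedding $f\colon\mathbb{T}\to\mathbb{C}$ with $\ell|a-b|\le|f(a)-f(b)|\le L|a-b|$ for all $a,b\in\mathbb{T}$ has a homeomorphic extension $F\colon\mathbb{C}\to\mathbb{C}$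 with $|F(a)-F(b)|\ge m|a-b|$ for all $a,b\in\mathbb{C}$. (2) A positive lower factor cannot depend on $\ell$ alone: for every $\ell>0$ and every $m>0$ there is $L\ge\ell$ such that $m$ is not admissible for $(\ell,L)$. (3) No lower factor is of larger order than $\ell^2/L$: there is an absolute constant $K>0$ such that $m\le K\ell^2/L$ whenever $0<\ell\le L$ and $m$ is admissible for $(\ell,L)$. -/

import Mathlib

open Set Topology
open scoped ENNReal NNReal

noncomputable section

/-- The Lipschitz constant `Lip(f)`, the supremum over `a ≠ b` of `|f(a) - f(b)| / |a - b|`,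
as an element of `[0, ∞]`. -/
def lipConst {X Y : Type*} [MetricSpace X] [MetricSpace Y] (f : X → Y) : ℝ≥0∞ :=
  ⨆ (a : X) (b : X) (_ : a ≠ b), edist (f a) (f b) / edist a b

/-- The circular arc `{r e^{it} : a ≤ t ≤ b}`. -/
def circArc (r a b : ℝ) : Set ℂ :=
  (fun t : ℝ => (r : ℂ) * Complex.exp (t * Complex.I)) '' Icc a b

/-- The radial segment `{r e^{it} : p ≤ r ≤ q}` (for `p ≤ q`). -/
def radialSegment (t p q : ℝ) : Set ℂ :=
  (fun r : ℝ => (r : ℂ) * Complex.exp (t * Complex.I)) '' Icc p q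

/-- The keyhole-shaped curve: four concentric arcs joined by four radial segments. -/
def keyholeCurve (ε : ℝ) : Set ℂ :=
  circArc 1 ε (2 * Real.pi - ε) ∪
  circArc 2 ε (Real.pi - ε) ∪
  circArc 2 (Real.pi + ε) (2 * Real.pi - ε) ∪
  circArc 3 (-Real.pi + ε) (Real.pi - ε) ∪
  radialSegment ε 1 2 ∪ radialSegment (-ε) 1 2 ∪
  radialSegment (Real.pi - ε) 2 3 ∪ radialSegment (Real.pi + ε) 2 3

/-- `f` parametrizes the keyhole curve by the unit circle: it is the identity on the long arc
`{e^{it} : ε ≤ t ≤ 2π - ε}`, and it runs through the rest of the curve with constant speed on the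
complementary arc. -/
structure IsKeyholeParam (ε : ℝ) (f : Circle → ℂ) : Prop where
  isEmbedding : IsEmbedding f
  range_eq : range f = keyholeCurve ε
  eq_self : ∀ z : Circle, (z : ℂ) ∈ circArc 1 ε (2 * Real.pi - ε) → f z = z
  constantSpeed : ∃ v : ℝ≥0,
    HasConstantSpeedOnWith (fun t : ℝ => f (Circle.exp t)) (Icc (-ε) ε) v

/-- `F` extends `f` from the unit circle to the plane. -/
def Extends (F : ℂ ≃ₜ ℂ) (f : Circle → ℂ) : Prop :=
  ∀ z : Circle, F z = f z

/-- `m` is an admissible lower factor for the pair `(l, L)`: every embedding `f` of the unit circle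
with `l|a-b| ≤ |f(a)-f(b)| ≤ L|a-b|` has a homeomorphic extension `F` to the plane with
`m|a-b| ≤ |F(a)-F(b)|` for all `a, b`. -/
def IsLowerFactor (l L m : ℝ) : Prop :=
  ∀ f : Circle → ℂ, IsEmbedding f →
    (∀ a b : Circle, l * dist a b ≤ dist (f a) (f b) ∧ dist (f a) (f b) ≤ L * dist a b) →
    ∃ F : ℂ ≃ₜ ℂ, Extends F f ∧ ∀ a b : ℂ, m * dist a b ≤ dist (F a) (F b)

end

/-!
Why an extension of a keyhole map has an inverse with a large Lipschitz constant: the curve has an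
outer corridor `{r e^{is} : 2 ≤ r ≤ 3, |s - π| < ε}`, and only through it can one travel to infinity
from the region between the circles of radius `1` and `2`. Remove the closed corridor from the open
disc of radius `3`. The boundary of this slit disc (`frontier_slitDisc_subset`) consists of points
of the curve of modulus at least `2`, and of the arc `γ = {2 e^{is} : |s - π| ≤ ε}` across the inner
mouth of the corridor. Let `F` extend the parametrization. For `ε ≤ t ≤ 2π - ε` the image under `F`
of the ray `{r e^{it} : r ≥ 1}` starts at `e^{it}`, inside the slit disc, and is unbounded, so it
meets that boundary; it meets the curve at `e^{it}` only, hence it meets `γ`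
(`exists_extension_eq_polarPoint_two`). No separation theorem for plane curves is needed. So the
radial projection of `F⁻¹(γ)` to the closed unit disc, which does not increase distances, covers
an arc of length `2π - 2ε`, while `γ` has length `4ε`. Lengths are compared by means of equally
spaced points on the arc: `card_sub_one_mul_le_of_pairwise` bounds the number of separated points
that fit into the parameter interval of `γ` (`le_lipConst_symm_of_extends`).

The parametrization `keyMap` is written in polar coordinates by arc length on the upper half of the
curve, and by reflection on the lower half. Its speed on `{e^{it} : |t| ≤ ε}` is of order `1 / ε`,
which gives `dist_keyMap_le`. The lower bound `half_dist_le_dist_keyMap` rests on the fact that the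
arguments `e^{is}`, `e^{it}` with `|s|, |t| ≤ ε` are at most `2 sin ε` apart: two pieces of the
curve that are not consecutive have at least half that distance, and on consecutive pieces the
large speed leaves ample room.

For the lower factors, `2l` times a keyhole parametrization with `ε = 72 l / L` satisfies the
hypotheses for the pair `(l, L)`, and the bound on the inverse of an extension reads
`m ≤ 144 l² / L`. When this `ε` is too large, `l² / L` is comparable to `l`, and `m ≤ l` follows
from the map `z ↦ l z`. Letting `L` tend to infinity excludes a lower factor that depends on
`l` alone.
-/

/-! ### Lipschitz constants -/

lemma lipConst_le_ofReal {X Y : Type*} [MetricSpace X] [MetricSpace Y] {f : X → Y} {K : ℝ}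
    (h : ∀ a b, dist (f a) (f b) ≤ K * dist a b) : lipConst f ≤ ENNReal.ofReal K := by
  refine iSup_le fun a => iSup_le fun b => iSup_le fun hab => ?_
  have hpos : 0 < dist a b := dist_pos.2 hab
  rw [edist_dist, edist_dist, ← ENNReal.ofReal_div_of_pos hpos]
  exact ENNReal.ofReal_le_ofReal ((div_le_iff₀ hpos).2 (h a b))

lemma dist_le_of_lipConst_le {X Y : Type*} [MetricSpace X] [MetricSpace Y] {f : X → Y} {K : ℝ}
    (hK : 0 ≤ K) (h : lipConst f ≤ ENNReal.ofReal K) (a b : X) :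
    dist (f a) (f b) ≤ K * dist a b := by
  rcases eq_or_ne a b with rfl | hab
  · simp
  have hpos : 0 < dist a b := dist_pos.2 hab
  have h1 : edist (f a) (f b) / edist a b ≤ lipConst f :=
    le_iSup_of_le a (le_iSup_of_le b (le_iSup_of_le hab le_rfl))
  have h2 := h1.trans h
  rw [edist_dist, edist_dist, ← ENNReal.ofReal_div_of_pos hpos,
    ENNReal.ofReal_le_ofReal_iff hK, div_le_iff₀ hpos] at h2
  exact h2

lemma ofReal_le_lipConst {X Y : Type*} [MetricSpace X] [MetricSpace Y] {f : X → Y} {K : ℝ}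
    {a b : X} (hab : a ≠ b) (h : K * dist a b ≤ dist (f a) (f b)) :
    ENNReal.ofReal K ≤ lipConst f := by
  have hpos : 0 < dist a b := dist_pos.2 hab
  refine le_iSup_of_le a (le_iSup_of_le b (le_iSup_of_le hab ?_))
  rw [edist_dist, edist_dist, ← ENNReal.ofReal_div_of_pos hpos]
  exact ENNReal.ofReal_le_ofReal ((le_div_iff₀ hpos).2 h)

/-! ### Distances in polar coordinates -/

/-- The point `r e^{iθ}` of the plane. -/
noncomputable def polarPoint (r θ : ℝ) : ℂ := (r : ℂ) * Complex.exp (θ * Complex.I)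

@[simp] lemma polarPoint_one (θ : ℝ) : polarPoint 1 θ = Circle.exp θ := by
  simp [polarPoint, Circle.coe_exp]

lemma norm_polarPoint {r : ℝ} (hr : 0 ≤ r) (θ : ℝ) : ‖polarPoint r θ‖ = r := by
  rw [polarPoint, norm_mul, Complex.norm_exp_ofReal_mul_I, mul_one, Complex.norm_real,
    Real.norm_of_nonneg hr]

lemma conj_polarPoint (r θ : ℝ) : starRingEnd ℂ (polarPoint r θ) = polarPoint r (-θ) := by
  simp [polarPoint, ← Complex.exp_conj]

lemma polarPoint_add_two_pi (r θ : ℝ) : polarPoint r (θ + 2 * Real.pi) = polarPoint r θ := by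
  simp only [polarPoint]
  congr 1
  rw [← Complex.exp_periodic ((θ : ℂ) * Complex.I)]
  push_cast
  ring_nf

lemma dist_polarPoint_sq (r r' θ θ' : ℝ) :
    dist (polarPoint r θ) (polarPoint r' θ') ^ 2 =
      (r - r') ^ 2 + 4 * (r * r') * Real.sin ((θ - θ') / 2) ^ 2 := by
  have h1 : Real.cos (θ - θ') = 1 - 2 * Real.sin ((θ - θ') / 2) ^ 2 := by
    rw [← Real.cos_two_mul_eq_one_sub]; ring_nf
  rw [dist_eq_norm, ← Complex.normSq_eq_norm_sq, Complex.normSq_apply]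
  simp only [polarPoint, Complex.sub_re, Complex.sub_im, Complex.re_ofReal_mul,
    Complex.im_ofReal_mul, Complex.exp_ofReal_mul_I_re, Complex.exp_ofReal_mul_I_im]
  rw [Real.cos_sub] at h1
  linear_combination r ^ 2 * Real.sin_sq_add_cos_sq θ + r' ^ 2 * Real.sin_sq_add_cos_sq θ' -
    2 * r * r' * h1

lemma dist_polarPoint_same_radius {r : ℝ} (hr : 0 ≤ r) (θ θ' : ℝ) :
    dist (polarPoint r θ) (polarPoint r θ') = 2 * r * |Real.sin ((θ - θ') / 2)| := by
  rw [← sq_eq_sq₀ dist_nonneg (by positivity), dist_polarPoint_sq, mul_pow, sq_abs]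
  ring

lemma dist_polarPoint_same_angle (r r' θ : ℝ) :
    dist (polarPoint r θ) (polarPoint r' θ) = |r - r'| := by
  rw [← sq_eq_sq₀ dist_nonneg (by positivity), dist_polarPoint_sq, sq_abs]
  simp

lemma abs_sub_le_dist_polarPoint {r r' : ℝ} (hr : 0 ≤ r) (hr' : 0 ≤ r') (θ θ' : ℝ) :
    |r - r'| ≤ dist (polarPoint r θ) (polarPoint r' θ') := by
  rw [← sq_le_sq₀ (abs_nonneg _) dist_nonneg, dist_polarPoint_sq, sq_abs]
  have : 0 ≤ r * r' := mul_nonneg hr hr'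
  nlinarith [mul_nonneg this (sq_nonneg (Real.sin ((θ - θ') / 2)))]

lemma dist_exp (s t : ℝ) : dist (Circle.exp s) (Circle.exp t) = 2 * |Real.sin ((s - t) / 2)| := by
  have := dist_polarPoint_same_radius zero_le_one s t
  rw [polarPoint_one, polarPoint_one, mul_one] at this
  exact this

/-- The radial projection onto the closed unit disc does not increase distances. -/
lemma dist_exp_le_dist_polarPoint {r r' : ℝ} (hr : 1 ≤ r) (hr' : 1 ≤ r') (θ θ' : ℝ) :
    dist (Circle.exp θ) (Circle.exp θ') ≤ dist (polarPoint r θ) (polarPoint r' θ') := by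
  rw [← sq_le_sq₀ dist_nonneg dist_nonneg, dist_polarPoint_sq, dist_exp, mul_pow, sq_abs]
  have h1 : 1 ≤ r * r' := one_le_mul_of_one_le_of_one_le hr hr'
  nlinarith [mul_nonneg (sub_nonneg.2 h1) (sq_nonneg (Real.sin ((θ - θ') / 2))), sq_nonneg (r - r')]

lemma dist_exp_le (s t : ℝ) : dist (Circle.exp s) (Circle.exp t) ≤ |s - t| := by
  rw [dist_exp]
  have := Real.abs_sin_le_abs (x := (s - t) / 2)
  rw [abs_div, abs_two] at this
  linarith

lemma dist_circle_le_two (a b : Circle) : dist a b ≤ 2 := by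
  rw [← Circle.exp_arg a, ← Circle.exp_arg b, dist_exp]
  linarith [Real.abs_sin_le_one ((Complex.arg a - Complex.arg b) / 2)]

/-- On the unit circle, points whose angles differ by at least `α` either way round
are at least as far apart as the ends of an arc of angle `α`. -/
lemma two_mul_sin_le_dist_exp {α s t : ℝ} (hα : 0 ≤ α) (h1 : α ≤ |s - t|)
    (h2 : |s - t| ≤ 2 * Real.pi - α) :
    2 * Real.sin (α / 2) ≤ dist (Circle.exp s) (Circle.exp t) := by
  rw [dist_exp]
  have key : ∀ x : ℝ, α ≤ x → x ≤ 2 * Real.pi - α → Real.sin (α / 2) ≤ Real.sin (x / 2) := by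
    intro x hx1 hx2
    rcases le_total x Real.pi with hx | hx
    · exact Real.sin_le_sin_of_le_of_le_pi_div_two (by linarith [Real.pi_pos]) (by linarith)
        (by linarith)
    · rw [← Real.sin_pi_sub (x / 2)]
      exact Real.sin_le_sin_of_le_of_le_pi_div_two (by linarith [Real.pi_pos]) (by linarith)
        (by linarith)
  have h3 := key _ h1 h2
  have h4 : Real.sin (|s - t| / 2) ≤ |Real.sin ((s - t) / 2)| := by
    rcases abs_cases (s - t) with ⟨h, _⟩ | ⟨h, _⟩ <;> rw [h]
    · exact le_abs_self _
    · rw [neg_div, Real.sin_neg]; exact neg_le_abs _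
  linarith

/-- Jordan's inequality in a weak form that reaches slightly beyond half a turn. -/
lemma abs_sub_le_two_mul_dist_exp {s t : ℝ} (h : |s - t| ≤ Real.pi + 1 / 10) :
    |s - t| ≤ 2 * dist (Circle.exp s) (Circle.exp t) := by
  have hpi := Real.pi_gt_three
  have hpi' := Real.pi_lt_d2
  rcases le_total |s - t| (Real.pi - 1 / 10) with h1 | h1
  · have h2 := two_mul_sin_le_dist_exp (abs_nonneg (s - t)) le_rfl (by linarith)
    have h3 := Real.mul_le_sin (x := |s - t| / 2) (by positivity) (by linarith)
    have h4 : 1 / 2 * (|s - t| / 2) ≤ 2 / Real.pi * (|s - t| / 2) := by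
      refine mul_le_mul_of_nonneg_right ?_ (by positivity)
      rw [div_le_div_iff₀] <;> linarith
    linarith
  · have h2 := two_mul_sin_le_dist_exp (α := Real.pi - 1 / 10) (by linarith) h1 (by linarith)
    have h3 := Real.mul_le_sin (x := (Real.pi - 1 / 10) / 2) (by linarith) (by linarith)
    have h4 : 2 / Real.pi * ((Real.pi - 1 / 10) / 2) = 1 - 1 / 10 / Real.pi := by
      field_simp
    have h5 : 1 / 10 / Real.pi ≤ 1 / 30 := by
      rw [div_le_iff₀] <;> linarith
    linarith

/-! ### Curves of constant speed -/

lemma tendsto_add_one_mul_comp_div {φ : ℝ → ℝ} {v : ℝ} (hφ : HasDerivAt φ v 0) (hφ0 : φ 0 = 0)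
    (c : ℝ) : Filter.Tendsto (fun n : ℕ => ((n : ℝ) + 1) * φ (c / (n + 1))) Filter.atTop
      (𝓝 (v * c)) := by
  have hd : HasDerivAt (fun s => φ (s * c)) (v * c) 0 := by
    have h0 : HasDerivAt (fun s : ℝ => s * c) c 0 := by
      simpa using (hasDerivAt_id (0 : ℝ)).mul_const c
    exact HasDerivAt.comp (0 : ℝ) (h₂ := φ) (by simpa using hφ) h0
  have h1 := hd.tendsto_slope_zero.comp
    (tendsto_nhdsWithin_iff.2 ⟨tendsto_one_div_add_atTop_nhds_zero_nat,
      Filter.Eventually.of_forall fun n => (by positivity : (1 / ((n : ℝ) + 1)) ≠ 0)⟩)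
  refine h1.congr fun n => ?_
  simp [hφ0, div_eq_inv_mul]

/-- A curve for which the distance of two points depends only on the difference of their
parameters has constant speed, the derivative at `0` of that dependence. -/
lemma hasConstantSpeedOnWith_Icc_of_dist_eq {E : Type*} [PseudoMetricSpace E] {g : ℝ → E}
    {a b : ℝ} {v : ℝ≥0} {φ : ℝ → ℝ} (hφ : HasDerivAt φ v 0) (hφle : ∀ d, 0 ≤ d → φ d ≤ v * d)
    (hg : ∀ x ∈ Icc a b, ∀ y ∈ Icc a b, x ≤ y → dist (g x) (g y) = φ (y - x)) :
    HasConstantSpeedOnWith g (Icc a b) v := by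
  rw [hasConstantSpeedOnWith_iff_ordered]
  intro x hx y hy hxy
  have hsub : Icc x y ⊆ Icc a b := Icc_subset_Icc hx.1 hy.2
  rw [inter_eq_self_of_subset_right hsub]
  apply le_antisymm
  · have hlip : LipschitzOnWith v g (Icc x y) := by
      refine LipschitzOnWith.of_dist_le_mul fun p hp q hq => ?_
      wlog hpq : p ≤ q generalizing p q
      · rw [dist_comm, dist_comm p]
        exact this q hq p hp (le_of_not_ge hpq)
      rw [hg p (hsub hp) q (hsub hq) hpq, dist_comm, Real.dist_eq,
        abs_of_nonneg (sub_nonneg.2 hpq)]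
      exact hφle _ (sub_nonneg.2 hpq)
    have h1 := hlip.comp_eVariationOn_le (g := id) (s := Icc x y) (fun z hz => hz)
    have h2 := (monotone_id.monotoneOn (Icc x y)).eVariationOn_eq (left_mem_Icc.2 hxy)
      (right_mem_Icc.2 hxy)
    rw [inter_self] at h2
    calc eVariationOn g (Icc x y) ≤ v * eVariationOn id (Icc x y) := h1
      _ = v * ENNReal.ofReal (id y - id x) := by rw [h2]
      _ = ENNReal.ofReal (v * (y - x)) := by
          rw [ENNReal.ofReal_mul v.coe_nonneg, ENNReal.ofReal_coe_nnreal]; rfl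
  · have hφ0 : φ 0 = 0 := by
      simpa using (hg x hx x hx le_rfl).symm
    -- equidistant subdivisions approximate the length from below
    -- the polygons inscribed at equidistant parameters approximate the length from below
    have hlim := ENNReal.tendsto_ofReal (tendsto_add_one_mul_comp_div hφ hφ0 (y - x))
    refine le_of_tendsto' hlim fun n => ?_
    have hn : (0 : ℝ) < n + 1 := by positivity
    let u : ℕ → ℝ := fun i => x + i * ((y - x) / (n + 1))
    have hstep : 0 ≤ (y - x) / (n + 1) := div_nonneg (sub_nonneg.2 hxy) hn.le
    have hu : Monotone u := fun i j hij => by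
      have : (i : ℝ) ≤ j := by exact_mod_cast hij
      simp only [u]
      gcongr
    have hmem : ∀ i ≤ n + 1, u i ∈ Icc x y := fun i hi => by
      have h0 : u 0 = x := by simp [u]
      have h1 : u (n + 1) = y := by simp only [u]; push_cast; field_simp; ring
      exact ⟨h0 ▸ hu (Nat.zero_le i), h1 ▸ hu hi⟩
    refine le_trans (le_of_eq ?_)
      (eVariationOn.sum_le_of_monotoneOn_Iic (n := n + 1) (hu.monotoneOn _) hmem)
    rw [Finset.sum_congr rfl (g := fun _ => ENNReal.ofReal (φ ((y - x) / (n + 1)))),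
      Finset.sum_const, Finset.card_range, nsmul_eq_mul, ENNReal.ofReal_mul hn.le]
    · congr 1
      rw [← ENNReal.ofReal_natCast]
      push_cast
      rfl
    · intro i hi
      have hi' := Finset.mem_range.1 hi
      rw [edist_comm, edist_dist, hg _ (hsub (hmem i hi'.le)) _ (hsub (hmem (i + 1) hi'))
        (hu (Nat.le_succ i))]
      congr 2
      simp only [u]
      push_cast
      ring

/-- Constant speed on the positive half of an interval carries over to the negative half of a
curve that is symmetric about the real axis. -/
lemma hasConstantSpeedOnWith_Icc_neg {g : ℝ → ℂ} {ε : ℝ} {v : ℝ≥0}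
    (hsymm : ∀ t ∈ Icc (-ε) 0, g t = starRingEnd ℂ (g (-t)))
    (h : HasConstantSpeedOnWith g (Icc 0 ε) v) : HasConstantSpeedOnWith g (Icc (-ε) 0) v := by
  rw [hasConstantSpeedOnWith_iff_ordered] at h ⊢
  intro x hx y hy hxy
  have hsub : Icc x y ⊆ Icc (-ε) 0 := Icc_subset_Icc hx.1 hy.2
  have hsub' : Icc (-y) (-x) ⊆ Icc 0 ε := by
    refine Icc_subset_Icc ?_ ?_ <;> linarith [hx.1, hy.2]
  have h1 := h (x := -y) (hsub' (left_mem_Icc.2 (by linarith))) (y := -x)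
    (hsub' (right_mem_Icc.2 (by linarith))) (by linarith)
  rw [inter_eq_self_of_subset_right hsub'] at h1
  rw [inter_eq_self_of_subset_right hsub]
  have h2 : eVariationOn g (Icc x y) = eVariationOn (fun t => starRingEnd ℂ (g (-t))) (Icc x y) :=
    eVariationOn.congr fun t ht => hsymm t (hsub ht)
  have h3 : eVariationOn (fun t => starRingEnd ℂ (g (-t))) (Icc x y) =
      eVariationOn (g ∘ Neg.neg) (Icc x y) := by
    simp only [eVariationOn, Function.comp, edist_dist, Complex.dist_conj_conj]
  have h4 := eVariationOn.comp_eq_of_antitoneOn g (Neg.neg : ℝ → ℝ) (t := Icc x y)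
    (fun p _ q _ hpq => neg_le_neg hpq)
  rw [h2, h3, h4, Set.image_neg_eq_neg, Set.neg_Icc, h1]
  congr 1
  ring

lemma hasConstantSpeedOnWith_circular {g : ℝ → ℂ} {a b r θ k : ℝ} {v : ℝ≥0} (hr : 0 ≤ r)
    (hv : r * |k| = v) (hk : |k| * (b - a) ≤ 2 * Real.pi)
    (hg : ∀ t ∈ Icc a b, g t = polarPoint r (θ + k * t)) :
    HasConstantSpeedOnWith g (Icc a b) v := by
  refine hasConstantSpeedOnWith_Icc_of_dist_eq (φ := fun d => 2 * r * Real.sin (|k| / 2 * d))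
    ?_ ?_ ?_
  · have h0 : HasDerivAt (fun d : ℝ => |k| / 2 * d) (|k| / 2) 0 := by
      simpa using (hasDerivAt_id (0 : ℝ)).const_mul (|k| / 2)
    convert! h0.sin.const_mul (2 * r) using 1
    rw [← hv]
    simp
    ring
  · intro d hd
    have h1 := Real.sin_le (x := |k| / 2 * d) (by positivity)
    rw [← hv]
    nlinarith
  · intro x hx y hy hxy
    rw [hg x hx, hg y hy, dist_polarPoint_same_radius hr]
    have h1 : 0 ≤ Real.sin (|k| / 2 * (y - x)) := by
      have h2 : 0 ≤ y - x := sub_nonneg.2 hxy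
      refine Real.sin_nonneg_of_nonneg_of_le_pi (by positivity) ?_
      have h3 : |k| * (y - x) ≤ |k| * (b - a) :=
        mul_le_mul_of_nonneg_left (by linarith [hx.1, hy.2]) (abs_nonneg k)
      linarith
    rw [← abs_of_nonneg h1]
    congr 1
    rcases abs_cases k with ⟨h, _⟩ | ⟨h, _⟩ <;> rw [h]
    · rw [← abs_neg, ← Real.sin_neg]; ring_nf
    · ring_nf

lemma hasConstantSpeedOnWith_radial {g : ℝ → ℂ} {a b c θ k : ℝ} {v : ℝ≥0} (hv : |k| = v)
    (hg : ∀ t ∈ Icc a b, g t = polarPoint (c + k * t) θ) :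
    HasConstantSpeedOnWith g (Icc a b) v := by
  refine hasConstantSpeedOnWith_Icc_of_dist_eq (φ := fun d => v * d) ?_ (fun d _ => le_rfl) ?_
  · simpa using (hasDerivAt_id (0 : ℝ)).const_mul (v : ℝ)
  · intro x hx y hy hxy
    rw [hg x hx, hg y hy, dist_polarPoint_same_angle, ← hv, ← abs_of_nonneg (sub_nonneg.2 hxy),
      ← abs_mul, ← abs_neg]
    ring_nf

/-! ### Packing points in an interval -/

/-- A set of reals with gaps at least `d` fits into an interval only if the gaps do. -/
lemma card_sub_one_mul_le_of_pairwise {d a b : ℝ} (S : Finset ℝ) (hS : S.Nonempty)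
    (hab : ∀ x ∈ S, x ∈ Icc a b) (hsep : ∀ x ∈ S, ∀ y ∈ S, x ≠ y → d ≤ |x - y|) :
    ((S.card : ℝ) - 1) * d ≤ b - a := by
  induction S using Finset.induction_on_max generalizing b with
  | empty => exact absurd hS (by simp)
  | insert m T hm ih =>
    have hmT : m ∉ T := fun h => lt_irrefl _ (hm m h)
    rw [Finset.card_insert_of_notMem hmT]
    have hmb := hab m (Finset.mem_insert_self m T)
    rcases T.eq_empty_or_nonempty with rfl | hT
    · simpa using hmb.1.trans hmb.2
    · have h1 := ih hT (b := m - d)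
        (fun x hx => ⟨(hab x (Finset.mem_insert_of_mem hx)).1, by
          have h2 := hsep m (Finset.mem_insert_self m T) x (Finset.mem_insert_of_mem hx)
            (ne_of_gt (hm x hx))
          rw [abs_of_pos (sub_pos.2 (hm x hx))] at h2
          linarith⟩)
        (fun x hx y hy => hsep x (Finset.mem_insert_of_mem hx) y (Finset.mem_insert_of_mem hy))
      push_cast
      linarith [hmb.2]

/-! ### The keyhole parametrization -/

/-- The constant speed of the keyhole parametrization on `{e^{it} : |t| ≤ ε}`: half the length of
the keyhole curve without its unit circular arc, over `ε`. -/
noncomputable def keySpeed (ε : ℝ) : ℝ := (5 * Real.pi + 2 - 7 * ε) / ε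

/-- The modulus of the point at distance `x`, along the upper half of the keyhole curve, from the
point `3`. -/
noncomputable def keyRadius (ε x : ℝ) : ℝ :=
  if x ≤ 3 * Real.pi - 3 * ε then 3
  else if x ≤ 3 * Real.pi - 3 * ε + 1 then 3 * Real.pi - 3 * ε + 3 - x
  else if x ≤ 5 * Real.pi - 7 * ε + 1 then 2
  else 5 * Real.pi - 7 * ε + 3 - x

/-- The angle of the point at distance `x`, along the upper half of the keyhole curve, from the
point `3`. -/
noncomputable def keyAngle (ε x : ℝ) : ℝ :=
  if x ≤ 3 * Real.pi - 3 * ε then x / 3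
  else if x ≤ 3 * Real.pi - 3 * ε + 1 then Real.pi - ε
  else if x ≤ 5 * Real.pi - 7 * ε + 1 then (5 * Real.pi - 5 * ε + 1 - x) / 2
  else ε

/-- The upper half of the keyhole curve without its unit circular arc, by arc length from the
point `3` to the point `e^{iε}`, for `0 ≤ x ≤ 5π + 2 - 7ε`. -/
noncomputable def keyHalf (ε x : ℝ) : ℂ := polarPoint (keyRadius ε x) (keyAngle ε x)

/-- The part of the keyhole curve off the unit circle, run through for `-ε ≤ t ≤ ε`. -/
noncomputable def keyArc (ε t : ℝ) : ℂ :=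
  if 0 ≤ t then keyHalf ε (keySpeed ε * t) else starRingEnd ℂ (keyHalf ε (keySpeed ε * (-t)))

/-- The parametrization of the keyhole curve by the unit circle. -/
noncomputable def keyMap (ε : ℝ) (z : Circle) : ℂ :=
  if |Complex.arg z| < ε then keyArc ε (Complex.arg z) else z

lemma keyHalf_cases (ε x : ℝ) :
    (x ≤ 3 * Real.pi - 3 * ε ∧ keyRadius ε x = 3 ∧ keyAngle ε x = x / 3) ∨
    (3 * Real.pi - 3 * ε ≤ x ∧ x ≤ 3 * Real.pi - 3 * ε + 1 ∧
      keyRadius ε x = 3 * Real.pi - 3 * ε + 3 - x ∧ keyAngle ε x = Real.pi - ε) ∨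
    (3 * Real.pi - 3 * ε + 1 ≤ x ∧ x ≤ 5 * Real.pi - 7 * ε + 1 ∧
      keyRadius ε x = 2 ∧ keyAngle ε x = (5 * Real.pi - 5 * ε + 1 - x) / 2) ∨
    (5 * Real.pi - 7 * ε + 1 ≤ x ∧
      keyRadius ε x = 5 * Real.pi - 7 * ε + 3 - x ∧ keyAngle ε x = ε) := by
  unfold keyRadius keyAngle
  split_ifs with h1 h2 h3
  · exact Or.inl ⟨h1, rfl, rfl⟩
  · exact Or.inr (Or.inl ⟨(not_le.1 h1).le, h2, rfl, rfl⟩)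
  · exact Or.inr (Or.inr (Or.inl ⟨(not_le.1 h2).le, h3, rfl, rfl⟩))
  · exact Or.inr (Or.inr (Or.inr ⟨(not_le.1 h3).le, rfl, rfl⟩))

lemma keyHalf_outer_arc {ε x : ℝ} (h : x ≤ 3 * Real.pi - 3 * ε) :
    keyHalf ε x = polarPoint 3 (x / 3) := by
  simp [keyHalf, keyRadius, keyAngle, h]

lemma keyHalf_outer_segment {ε x : ℝ} (h1 : 3 * Real.pi - 3 * ε ≤ x)
    (h2 : x ≤ 3 * Real.pi - 3 * ε + 1) :
    keyHalf ε x = polarPoint (3 * Real.pi - 3 * ε + 3 - x) (Real.pi - ε) := by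
  unfold keyHalf keyRadius keyAngle
  split_ifs
  · congr 1 <;> linarith
  · rfl

lemma keyHalf_middle_arc {ε x : ℝ} (h1 : 3 * Real.pi - 3 * ε + 1 ≤ x)
    (h2 : x ≤ 5 * Real.pi - 7 * ε + 1) :
    keyHalf ε x = polarPoint 2 ((5 * Real.pi - 5 * ε + 1 - x) / 2) := by
  unfold keyHalf keyRadius keyAngle
  split_ifs
  · congr 1 <;> linarith
  · congr 1 <;> linarith
  · rfl

lemma keyHalf_inner_segment {ε x : ℝ} (hε : ε ≤ 1 / 10) (h1 : 5 * Real.pi - 7 * ε + 1 ≤ x) :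
    keyHalf ε x = polarPoint (5 * Real.pi - 7 * ε + 3 - x) ε := by
  have := Real.pi_gt_three
  unfold keyHalf keyRadius keyAngle
  split_ifs
  · congr 1 <;> linarith
  · congr 1 <;> linarith
  · congr 1 <;> linarith
  · rfl

lemma one_le_keyRadius {ε x : ℝ} (hx : x ≤ 5 * Real.pi + 2 - 7 * ε) :
    1 ≤ keyRadius ε x := by
  rcases keyHalf_cases ε x with ⟨h1, h, h'⟩ | ⟨h1, h2, h, h'⟩ | ⟨h1, h2, h, h'⟩ | ⟨h1, h, h'⟩ <;>
    linarith

lemma keyAngle_mem {ε x : ℝ} (hε : 0 < ε) (hε' : ε ≤ 1 / 10) (hx0 : 0 ≤ x) :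
    keyAngle ε x ∈ Icc 0 (Real.pi - ε) := by
  have := Real.pi_gt_three
  rcases keyHalf_cases ε x with ⟨h1, h, h'⟩ | ⟨h1, h2, h, h'⟩ | ⟨h1, h2, h, h'⟩ | ⟨h1, h, h'⟩ <;>
    constructor <;> linarith

/-- Points of the upper half that are close in modulus and in angle lie on the same piece or on
consecutive ones, since any other two pieces are far apart. -/
lemma abs_sub_le_of_keyHalf {ε x y : ℝ} (hε' : ε ≤ 1 / 10)
    (hr : |keyRadius ε x - keyRadius ε y| < ε) (ha : |keyAngle ε x - keyAngle ε y| < ε) :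
    |x - y| ≤ |keyRadius ε x - keyRadius ε y| + 3 * |keyAngle ε x - keyAngle ε y| := by
  have := Real.pi_gt_three
  rcases abs_lt.1 hr with ⟨hr1, hr2⟩
  rcases abs_lt.1 ha with ⟨ha1, ha2⟩
  have k1 := le_abs_self (keyRadius ε x - keyRadius ε y)
  have k2 := neg_le_abs (keyRadius ε x - keyRadius ε y)
  have k3 := le_abs_self (keyAngle ε x - keyAngle ε y)
  have k4 := neg_le_abs (keyAngle ε x - keyAngle ε y)
  generalize |keyRadius ε x - keyRadius ε y| = R at *
  generalize |keyAngle ε x - keyAngle ε y| = A at *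
  rw [abs_le]
  rcases keyHalf_cases ε x with ⟨h1, h, h'⟩ | ⟨h1, h2, h, h'⟩ | ⟨h1, h2, h, h'⟩ | ⟨h1, h, h'⟩ <;>
  rcases keyHalf_cases ε y with ⟨p1, p, p'⟩ | ⟨p1, p2, p, p'⟩ | ⟨p1, p2, p, p'⟩ | ⟨p1, p, p'⟩ <;>
  rw [h, p] at hr1 hr2 k1 k2 <;> rw [h', p'] at ha1 ha2 k3 k4 <;> constructor <;> linarith

/-- Only the outer arc comes closer to the real axis than the angle `ε`. -/
lemma eq_three_mul_keyAngle {ε x : ℝ} (hε' : ε ≤ 1 / 10) (ha : keyAngle ε x < ε) :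
    x = 3 * keyAngle ε x := by
  have := Real.pi_gt_three
  rcases keyHalf_cases ε x with ⟨h1, h, h'⟩ | ⟨h1, h2, h, h'⟩ | ⟨h1, h2, h, h'⟩ | ⟨h1, h, h'⟩ <;>
    linarith

lemma keySpeed_mul_self {ε : ℝ} (hε : 0 < ε) :
    keySpeed ε * ε = 5 * Real.pi + 2 - 7 * ε := by
  unfold keySpeed; field_simp

lemma keySpeed_ge {ε : ℝ} (hε : 0 < ε) (hε' : ε ≤ 1 / 10) : 150 ≤ keySpeed ε := by
  have := Real.pi_gt_three
  rw [keySpeed, le_div_iff₀ hε]; linarith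

lemma keySpeed_le {ε : ℝ} (hε : 0 < ε) : keySpeed ε ≤ 18 / ε := by
  have := Real.pi_lt_d2
  unfold keySpeed
  gcongr
  linarith

lemma keySpeed_mul_mem {ε t : ℝ} (hε : 0 < ε) (hε' : ε ≤ 1 / 10) (ht : t ∈ Icc 0 ε) :
    keySpeed ε * t ∈ Icc 0 (5 * Real.pi + 2 - 7 * ε) := by
  have hv := keySpeed_ge hε hε'
  refine ⟨mul_nonneg (by linarith) ht.1, ?_⟩
  rw [← keySpeed_mul_self hε]
  exact mul_le_mul_of_nonneg_left ht.2 (by linarith)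

lemma keyArc_of_nonneg {ε t : ℝ} (ht : 0 ≤ t) : keyArc ε t = keyHalf ε (keySpeed ε * t) := by
  rw [keyArc, if_pos ht]

lemma keyArc_zero {ε : ℝ} (hε' : ε ≤ 1 / 10) : keyArc ε 0 = 3 := by
  have := Real.pi_gt_three
  rw [keyArc_of_nonneg le_rfl, keyHalf_outer_arc (by linarith)]
  simp [polarPoint]

lemma keyArc_neg {ε : ℝ} (hε' : ε ≤ 1 / 10) (t : ℝ) :
    keyArc ε (-t) = starRingEnd ℂ (keyArc ε t) := by
  rcases lt_trichotomy t 0 with h | rfl | h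
  · rw [keyArc, keyArc, if_pos (by linarith), if_neg (by linarith), Complex.conj_conj]
  · rw [neg_zero, keyArc_zero hε']
    exact (Complex.conj_ofNat 3).symm
  · rw [keyArc, keyArc, if_neg (by linarith), if_pos h.le, neg_neg]

lemma keyArc_self {ε : ℝ} (hε : 0 < ε) (hε' : ε ≤ 1 / 10) : keyArc ε ε = Circle.exp ε := by
  rw [keyArc_of_nonneg hε.le, keySpeed_mul_self hε, keyHalf_inner_segment hε' (by linarith),
    ← polarPoint_one]
  congr 1
  ring

lemma coe_exp_neg (t : ℝ) : (Circle.exp (-t) : ℂ) = starRingEnd ℂ (Circle.exp t : ℂ) := by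
  rw [← polarPoint_one, ← polarPoint_one, conj_polarPoint]

lemma keyArc_neg_self {ε : ℝ} (hε : 0 < ε) (hε' : ε ≤ 1 / 10) :
    keyArc ε (-ε) = Circle.exp (-ε) := by
  rw [keyArc_neg hε', keyArc_self hε hε', coe_exp_neg]

lemma keyMap_of_le {ε : ℝ} {z : Circle} (h : ε ≤ |Complex.arg z|) : keyMap ε z = z := by
  rw [keyMap, if_neg (not_lt.2 h)]

lemma keyMap_exp {ε t : ℝ} (hε : 0 < ε) (hε' : ε ≤ 1 / 10) (ht : t ∈ Icc (-ε) ε) :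
    keyMap ε (Circle.exp t) = keyArc ε t := by
  have hpi := Real.pi_gt_three
  have harg : Complex.arg (Circle.exp t) = t :=
    Circle.arg_exp (by linarith [ht.1]) (by linarith [ht.2])
  rw [keyMap, harg]
  split_ifs with h
  · rfl
  · rcases le_abs'.1 (not_lt.1 h) with h1 | h1
    · rw [le_antisymm h1 ht.1, keyArc_neg_self hε hε']
    · rw [le_antisymm ht.2 h1, keyArc_self hε hε']

/-- On `{e^{it} : ε ≤ t ≤ 2π - ε}` the keyhole parametrization is the identity. -/
lemma keyMap_exp_of_mem {ε t : ℝ} (hε : 0 < ε) (hε' : ε ≤ 1 / 10)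
    (ht : t ∈ Icc ε (2 * Real.pi - ε)) : keyMap ε (Circle.exp t) = Circle.exp t := by
  have hpi := Real.pi_gt_three
  apply keyMap_of_le
  rcases le_or_gt t Real.pi with h | h
  · rw [Circle.arg_exp (by linarith [ht.1]) h]
    exact ht.1.trans (le_abs_self t)
  · rw [← Circle.exp_sub_two_pi, Circle.arg_exp (by linarith) (by linarith [ht.2])]
    exact le_trans (by linarith [ht.2]) (neg_le_abs _)

/-! ### The keyhole parametrization has constant speed -/

lemma hasConstantSpeedOnWith_keyArc {ε : ℝ} (hε : 0 < ε) (hε' : ε ≤ 1 / 10) :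
    HasConstantSpeedOnWith (keyArc ε) (Icc (-ε) ε) (keySpeed ε).toNNReal := by
  have hpi := Real.pi_gt_three
  have hv := keySpeed_ge hε hε'
  have hv0 : 0 < keySpeed ε := by linarith
  have hve := keySpeed_mul_self hε
  have hcoe : ((keySpeed ε).toNNReal : ℝ) = keySpeed ε := Real.coe_toNNReal _ hv0.le
  have hhalf : HasConstantSpeedOnWith (keyArc ε) (Icc 0 ε) (keySpeed ε).toNNReal := by
    set v := keySpeed ε
    have e1 : v * ((3 * Real.pi - 3 * ε) / v) = 3 * Real.pi - 3 * ε := by field_simp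
    have e2 : v * ((3 * Real.pi - 3 * ε + 1) / v) = 3 * Real.pi - 3 * ε + 1 := by field_simp
    have e3 : v * ((5 * Real.pi - 7 * ε + 1) / v) = 5 * Real.pi - 7 * ε + 1 := by field_simp
    have hle : ∀ {p q : ℝ}, p ≤ q → v * p ≤ v * q := fun h => mul_le_mul_of_nonneg_left h hv0.le
    have h1 : 0 ≤ (3 * Real.pi - 3 * ε) / v := div_nonneg (by linarith) hv0.le
    have h2 : 0 ≤ (3 * Real.pi - 3 * ε + 1) / v := div_nonneg (by linarith) hv0.le
    have h3 : 0 ≤ (5 * Real.pi - 7 * ε + 1) / v := div_nonneg (by linarith) hv0.le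
    refine HasConstantSpeedOnWith.Icc_Icc (y := (3 * Real.pi - 3 * ε) / v) ?_
      (HasConstantSpeedOnWith.Icc_Icc (y := (3 * Real.pi - 3 * ε + 1) / v) ?_
      (HasConstantSpeedOnWith.Icc_Icc (y := (5 * Real.pi - 7 * ε + 1) / v) ?_ ?_))
    · refine hasConstantSpeedOnWith_circular (r := 3) (θ := 0) (k := v / 3) (by norm_num) ?_ ?_ ?_
      · rw [hcoe, abs_of_pos (by positivity)]; ring
      · rw [abs_of_pos (by positivity)]; linarith
      · intro t ht
        rw [keyArc_of_nonneg ht.1, keyHalf_outer_arc (e1 ▸ hle ht.2)]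
        congr 1
        ring
    · refine hasConstantSpeedOnWith_radial (c := 3 * Real.pi - 3 * ε + 3) (θ := Real.pi - ε)
        (k := -v) (by rw [hcoe, abs_neg, abs_of_pos hv0]) ?_
      intro t ht
      rw [keyArc_of_nonneg (h1.trans ht.1), keyHalf_outer_segment (e1 ▸ hle ht.1) (e2 ▸ hle ht.2)]
      congr 1
      ring
    · refine hasConstantSpeedOnWith_circular (r := 2) (θ := (5 * Real.pi - 5 * ε + 1) / 2)
        (k := -(v / 2)) (by norm_num) ?_ ?_ ?_
      · rw [hcoe, abs_neg, abs_of_pos (by positivity)]; ring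
      · rw [abs_neg, abs_of_pos (by positivity)]; linarith
      · intro t ht
        rw [keyArc_of_nonneg (h2.trans ht.1), keyHalf_middle_arc (e2 ▸ hle ht.1) (e3 ▸ hle ht.2)]
        congr 1
        ring
    · refine hasConstantSpeedOnWith_radial (c := 5 * Real.pi - 7 * ε + 3) (θ := ε)
        (k := -v) (by rw [hcoe, abs_neg, abs_of_pos hv0]) ?_
      intro t ht
      rw [keyArc_of_nonneg (h3.trans ht.1), keyHalf_inner_segment hε' (e3 ▸ hle ht.1)]
      congr 1
      ring
  refine HasConstantSpeedOnWith.Icc_Icc (y := 0) (hasConstantSpeedOnWith_Icc_neg ?_ hhalf) hhalf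
  intro t _
  rw [keyArc_neg hε', Complex.conj_conj]

lemma dist_keyArc_le {ε s t : ℝ} (hε : 0 < ε) (hε' : ε ≤ 1 / 10) (hs : s ∈ Icc (-ε) ε)
    (ht : t ∈ Icc (-ε) ε) : dist (keyArc ε s) (keyArc ε t) ≤ keySpeed ε * |s - t| := by
  wlog hst : s ≤ t generalizing s t
  · rw [dist_comm, abs_sub_comm]
    exact this ht hs (le_of_not_ge hst)
  have hv := keySpeed_ge hε hε'
  have h := hasConstantSpeedOnWith_keyArc hε hε' hs ht
  have h1 := eVariationOn.edist_le (keyArc ε) (s := Icc (-ε) ε ∩ Icc s t)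
    ⟨hs, left_mem_Icc.2 hst⟩ ⟨ht, right_mem_Icc.2 hst⟩
  rw [h, Real.coe_toNNReal _ (by linarith), edist_dist, ENNReal.ofReal_le_ofReal_iff
    (mul_nonneg (by linarith) (sub_nonneg.2 hst))] at h1
  rwa [abs_sub_comm, abs_of_nonneg (sub_nonneg.2 hst)]

/-! ### The keyhole parametrization is bilipschitz -/

lemma dist_keyMap_le {ε : ℝ} (hε : 0 < ε) (hε' : ε ≤ 1 / 10) (a b : Circle) :
    dist (keyMap ε a) (keyMap ε b) ≤ 36 / ε * dist a b := by
  have hv := keySpeed_ge hε hε'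
  have hpi := Real.pi_gt_three
  suffices h : dist (keyMap ε a) (keyMap ε b) ≤ keySpeed ε * (2 * dist a b) by
    have h1 : keySpeed ε * (2 * dist a b) ≤ 18 / ε * (2 * dist a b) :=
      mul_le_mul_of_nonneg_right (keySpeed_le hε) (by positivity)
    have h2 : 18 / ε * (2 * dist a b) = 36 / ε * dist a b := by ring
    linarith
  -- one point on the arc around `1`, the other one off it: pass through an end of that arc
  have mixed : ∀ a b : Circle, |Complex.arg a| ≤ ε → ε ≤ |Complex.arg b| →
      dist (keyMap ε a) (keyMap ε b) ≤ keySpeed ε * (2 * dist a b) := by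
    intro a b ha hb
    have hb1 := Complex.neg_pi_lt_arg b
    have hb2 := Complex.arg_le_pi b
    rw [keyMap_of_le hb]
    nth_rw 1 [← Circle.exp_arg a, ← Circle.exp_arg b]
    rw [keyMap_exp hε hε' (abs_le.1 ha)]
    have h0 := abs_sub_le_two_mul_dist_exp (s := Complex.arg a) (t := Complex.arg b) (by
      rw [abs_le]; constructor <;> linarith [(abs_le.1 ha).1, (abs_le.1 ha).2])
    rw [Circle.exp_arg, Circle.exp_arg] at h0
    refine le_trans ?_ (mul_le_mul_of_nonneg_left h0 (by linarith))
    generalize Complex.arg a = s at *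
    generalize Complex.arg b = t at *
    have key : ∀ e : ℝ, e ∈ Icc (-ε) ε → keyArc ε e = Circle.exp e →
        |s - e| + |e - t| = |s - t| →
        dist (keyArc ε s) (Circle.exp t) ≤ keySpeed ε * |s - t| := by
      intro e he hee hsum
      have h1 := dist_triangle (keyArc ε s) (keyArc ε e) (Circle.exp t)
      have h2 := dist_keyArc_le hε hε' (abs_le.1 ha) he
      have h3 : dist (keyArc ε e) (Circle.exp t) ≤ |e - t| := by
        rw [hee]; exact dist_exp_le e t
      nlinarith [abs_nonneg (e - t)]
    rcases le_abs'.1 hb with h | h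
    · refine key (-ε) ⟨le_rfl, by linarith⟩ (keyArc_neg_self hε hε') ?_
      have := (abs_le.1 ha).1
      rw [abs_of_nonneg, abs_of_nonneg, abs_of_nonneg] <;> linarith
    · refine key ε ⟨by linarith, le_rfl⟩ (keyArc_self hε hε') ?_
      have := (abs_le.1 ha).2
      rw [abs_of_nonpos, abs_of_nonpos, abs_of_nonpos] <;> linarith
  rcases le_total |Complex.arg a| ε with ha | ha <;> rcases le_total |Complex.arg b| ε with hb | hb
  · have h0 := abs_sub_le_two_mul_dist_exp (s := Complex.arg a) (t := Complex.arg b) (by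
      rw [abs_le]
      constructor <;>
        linarith [(abs_le.1 ha).1, (abs_le.1 ha).2, (abs_le.1 hb).1, (abs_le.1 hb).2])
    rw [Circle.exp_arg, Circle.exp_arg] at h0
    nth_rw 1 [← Circle.exp_arg a, ← Circle.exp_arg b]
    rw [keyMap_exp hε hε' (abs_le.1 ha), keyMap_exp hε hε' (abs_le.1 hb)]
    exact (dist_keyArc_le hε hε' (abs_le.1 ha) (abs_le.1 hb)).trans
      (mul_le_mul_of_nonneg_left h0 (by linarith))
  · exact mixed a b ha hb
  · rw [dist_comm, dist_comm a]
    exact mixed b a hb ha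
  · rw [keyMap_of_le ha, keyMap_of_le hb]
    have h : dist (a : ℂ) b = dist a b := rfl
    rw [h]
    nlinarith [dist_nonneg (x := a) (y := b)]

/-- Two points on the same side of the real axis: either the two are apart in angle
or modulus, or they lie on the same smooth piece or on consecutive ones. -/
lemma half_dist_exp_le_dist_keyHalf {ε s t : ℝ} (hε : 0 < ε) (hε' : ε ≤ 1 / 10)
    (hs : s ∈ Icc 0 ε) (ht : t ∈ Icc 0 ε) :
    1 / 2 * dist (Circle.exp s) (Circle.exp t) ≤
      dist (keyHalf ε (keySpeed ε * s)) (keyHalf ε (keySpeed ε * t)) := by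
  have hpi := Real.pi_gt_three
  have hv := keySpeed_ge hε hε'
  obtain ⟨hx0, hx1⟩ := keySpeed_mul_mem hε hε' hs
  obtain ⟨hy0, hy1⟩ := keySpeed_mul_mem hε hε' ht
  have hst : |s - t| ≤ ε := by rw [abs_le]; constructor <;> linarith [hs.1, hs.2, ht.1, ht.2]
  have hE := dist_exp_le s t
  have hvst : |keySpeed ε * s - keySpeed ε * t| = keySpeed ε * |s - t| := by
    rw [← mul_sub, abs_mul, abs_of_pos (by linarith : 0 < keySpeed ε)]
  generalize keySpeed ε * s = x at *
  generalize keySpeed ε * t = y at *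
  have rx := one_le_keyRadius hx1
  have ry := one_le_keyRadius hy1
  obtain ⟨ax0, ax1⟩ := keyAngle_mem hε hε' hx0
  obtain ⟨ay0, ay1⟩ := keyAngle_mem hε hε' hy0
  have hD1 := abs_sub_le_dist_polarPoint (zero_le_one.trans rx) (zero_le_one.trans ry)
    (keyAngle ε x) (keyAngle ε y)
  have hD2 := dist_exp_le_dist_polarPoint rx ry (keyAngle ε x) (keyAngle ε y)
  have hang : |keyAngle ε x - keyAngle ε y| ≤ Real.pi - ε := by
    rw [abs_le]; constructor <;> linarith
  have hD3 := abs_sub_le_two_mul_dist_exp (s := keyAngle ε x) (t := keyAngle ε y) (by linarith)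
  change _ ≤ dist (polarPoint _ _) (polarPoint _ _)
  by_cases h1 : ε ≤ |keyRadius ε x - keyRadius ε y|
  · linarith
  by_cases h2 : ε ≤ |keyAngle ε x - keyAngle ε y|
  · linarith
  have h3 := abs_sub_le_of_keyHalf hε' (not_le.1 h1) (not_le.1 h2)
  nlinarith [abs_nonneg (s - t)]

/-- Two points on opposite sides of the real axis: unless their angles differ
considerably, both lie on the outer arc. -/
lemma half_dist_exp_le_dist_keyHalf_conj {ε s t : ℝ} (hε : 0 < ε) (hε' : ε ≤ 1 / 10)
    (hs : s ∈ Icc 0 ε) (ht : t ∈ Icc 0 ε) :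
    1 / 2 * dist (Circle.exp s) (Circle.exp (-t)) ≤
      dist (keyHalf ε (keySpeed ε * s)) (starRingEnd ℂ (keyHalf ε (keySpeed ε * t))) := by
  have hpi := Real.pi_gt_three
  have hv := keySpeed_ge hε hε'
  obtain ⟨hx0, hx1⟩ := keySpeed_mul_mem hε hε' hs
  obtain ⟨hy0, hy1⟩ := keySpeed_mul_mem hε hε' ht
  have hE := dist_exp_le s (-t)
  have hst0 : 0 ≤ s + t := by linarith [hs.1, ht.1]
  rw [sub_neg_eq_add, abs_of_nonneg hst0] at hE
  have hE2 : 1 / 2 * dist (Circle.exp s) (Circle.exp (-t)) ≤ Real.sin ε := by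
    have h1 : Real.sin ((s + t) / 2) ≤ Real.sin ε :=
      Real.sin_le_sin_of_le_of_le_pi_div_two (by linarith) (by linarith) (by linarith [hs.2, ht.2])
    rw [dist_exp, sub_neg_eq_add, abs_of_nonneg]
    · linarith
    · exact Real.sin_nonneg_of_nonneg_of_le_pi (by linarith) (by linarith [hs.2, ht.2])
  have hsin : Real.sin ε ≤ 2 * Real.sin (ε / 2) := by
    have h1 : Real.sin ε = 2 * Real.sin (ε / 2) * Real.cos (ε / 2) := by
      rw [← Real.sin_two_mul]; ring_nf
    have h2 : 0 ≤ Real.sin (ε / 2) :=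
      Real.sin_nonneg_of_nonneg_of_le_pi (by linarith) (by linarith)
    nlinarith [Real.cos_le_one (ε / 2)]
  have hvst : keySpeed ε * s + keySpeed ε * t = keySpeed ε * (s + t) := by ring
  generalize keySpeed ε * s = x at *
  generalize keySpeed ε * t = y at *
  have rx := one_le_keyRadius hx1
  have ry := one_le_keyRadius hy1
  obtain ⟨ax0, ax1⟩ := keyAngle_mem hε hε' hx0
  obtain ⟨ay0, ay1⟩ := keyAngle_mem hε hε' hy0
  have hD := dist_exp_le_dist_polarPoint rx ry (keyAngle ε x) (-keyAngle ε y)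
  have habs : |keyAngle ε x - -keyAngle ε y| = keyAngle ε x + keyAngle ε y := by
    rw [sub_neg_eq_add, abs_of_nonneg (by linarith)]
  rw [keyHalf, keyHalf, conj_polarPoint]
  rcases le_or_gt ε (keyAngle ε x + keyAngle ε y) with h | h
  · have := two_mul_sin_le_dist_exp (s := keyAngle ε x) (t := -keyAngle ε y) hε.le
      (by linarith) (by linarith)
    linarith
  · have h1 := eq_three_mul_keyAngle hε' (x := x) (by linarith)
    have h2 := eq_three_mul_keyAngle hε' (x := y) (by linarith)
    have h3 := abs_sub_le_two_mul_dist_exp (s := keyAngle ε x) (t := -keyAngle ε y) (by linarith)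
    nlinarith

/-- One point on the upper half of the keyhole curve, the other one on the unit circle: either
their moduli differ by `1`, or the first one lies on the segment at angle `ε`, and the estimate
passes through `e^{iε}`. -/
lemma half_dist_exp_le_dist_keyHalf_exp {ε s : ℝ} (hε : 0 < ε) (hε' : ε ≤ 1 / 10)
    (hs : s ∈ Icc 0 ε) (t : ℝ) :
    1 / 2 * dist (Circle.exp s) (Circle.exp t) ≤
      dist (keyHalf ε (keySpeed ε * s)) (Circle.exp t) := by
  have hv := keySpeed_ge hε hε'
  have hve := keySpeed_mul_self hε
  obtain ⟨hx0, hx1⟩ := keySpeed_mul_mem hε hε' hs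
  have rx := one_le_keyRadius hx1
  rw [← polarPoint_one, keyHalf]
  have hD1 := abs_sub_le_dist_polarPoint (zero_le_one.trans rx) zero_le_one
    (keyAngle ε (keySpeed ε * s)) t
  have hD2 := dist_exp_le_dist_polarPoint rx le_rfl (keyAngle ε (keySpeed ε * s)) t
  have h2 := dist_circle_le_two (Circle.exp s) (Circle.exp t)
  rw [abs_of_nonneg (by linarith)] at hD1
  rcases keyHalf_cases ε (keySpeed ε * s) with
    ⟨h1, h, h'⟩ | ⟨h1, h2, h, h'⟩ | ⟨h1, h2, h, h'⟩ | ⟨h1, h, h'⟩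
  · linarith
  · linarith
  · linarith
  · have h3 := dist_triangle (Circle.exp s) (Circle.exp ε) (Circle.exp t)
    have h4 := dist_exp_le s ε
    rw [abs_sub_comm, abs_of_nonneg (by linarith [hs.2])] at h4
    have h5 : 0 ≤ (keySpeed ε - 1) * (ε - s) := mul_nonneg (by linarith) (by linarith [hs.2])
    rw [h'] at hD1 hD2 ⊢
    nlinarith

lemma half_dist_le_dist_keyMap {ε : ℝ} (hε : 0 < ε) (hε' : ε ≤ 1 / 10) (a b : Circle) :
    1 / 2 * dist a b ≤ dist (keyMap ε a) (keyMap ε b) := by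
  have hconj : ∀ s t : ℝ, dist (Circle.exp (-s)) (Circle.exp (-t)) =
      dist (Circle.exp s) (Circle.exp t) := fun s t => by
    rw [dist_exp, dist_exp, ← abs_neg, ← Real.sin_neg]; ring_nf
  have hneg : ∀ s : ℝ, s ≤ 0 → keyArc ε s = starRingEnd ℂ (keyHalf ε (keySpeed ε * (-s))) := by
    intro s hs
    rw [← keyArc_of_nonneg (by linarith), keyArc_neg hε', Complex.conj_conj]
  have mixed : ∀ s ∈ Icc (-ε) ε, ∀ t, 1 / 2 * dist (Circle.exp s) (Circle.exp t) ≤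
      dist (keyArc ε s) (Circle.exp t) := by
    intro s hs t
    rcases le_total 0 s with h | h
    · rw [keyArc_of_nonneg h]
      exact half_dist_exp_le_dist_keyHalf_exp hε hε' ⟨h, hs.2⟩ t
    · have h1 := half_dist_exp_le_dist_keyHalf_exp hε hε' (s := -s)
        ⟨by linarith, by linarith [hs.1]⟩ (-t)
      rwa [hconj, coe_exp_neg, ← Complex.dist_conj_conj, Complex.conj_conj, ← hneg s h] at h1
  have inner : ∀ s ∈ Icc (-ε) ε, ∀ t ∈ Icc (-ε) ε,
      1 / 2 * dist (Circle.exp s) (Circle.exp t) ≤ dist (keyArc ε s) (keyArc ε t) := by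
    intro s hs t ht
    rcases le_total 0 s with h | h <;> rcases le_total 0 t with h' | h'
    · rw [keyArc_of_nonneg h, keyArc_of_nonneg h']
      exact half_dist_exp_le_dist_keyHalf hε hε' ⟨h, hs.2⟩ ⟨h', ht.2⟩
    · rw [keyArc_of_nonneg h, hneg t h']
      simpa using half_dist_exp_le_dist_keyHalf_conj hε hε' ⟨h, hs.2⟩ (t := -t)
        ⟨by linarith, by linarith [ht.1]⟩
    · rw [keyArc_of_nonneg h', hneg s h, dist_comm, dist_comm (starRingEnd ℂ _)]
      simpa using half_dist_exp_le_dist_keyHalf_conj hε hε' ⟨h', ht.2⟩ (t := -s)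
        ⟨by linarith, by linarith [hs.1]⟩
    · rw [hneg s h, hneg t h', Complex.dist_conj_conj, ← hconj]
      exact half_dist_exp_le_dist_keyHalf hε hε' ⟨by linarith, by linarith [hs.1]⟩
        ⟨by linarith, by linarith [ht.1]⟩
  have hval : ∀ z : Circle, |Complex.arg z| ≤ ε → keyMap ε z = keyArc ε (Complex.arg z) := by
    intro z hz
    rw [← keyMap_exp hε hε' (abs_le.1 hz), Circle.exp_arg]
  rcases le_total |Complex.arg a| ε with ha | ha <;> rcases le_total |Complex.arg b| ε with hb | hb
  · rw [hval a ha, hval b hb]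
    simpa only [Circle.exp_arg] using inner _ (abs_le.1 ha) _ (abs_le.1 hb)
  · rw [hval a ha, keyMap_of_le hb]
    simpa only [Circle.exp_arg] using mixed _ (abs_le.1 ha) (Complex.arg b)
  · rw [hval b hb, keyMap_of_le ha, dist_comm, dist_comm (a : ℂ)]
    simpa only [Circle.exp_arg] using mixed _ (abs_le.1 hb) (Complex.arg a)
  · rw [keyMap_of_le ha, keyMap_of_le hb]
    have h : dist (a : ℂ) b = dist a b := rfl
    rw [h]
    linarith [dist_nonneg (x := a) (y := b)]

/-! ### Membership in the keyhole curve -/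

lemma polarPoint_mem_circArc {r a b t : ℝ} (ht : t ∈ Icc a b) : polarPoint r t ∈ circArc r a b :=
  ⟨t, ht, rfl⟩

lemma polarPoint_mem_radialSegment {t p q r : ℝ} (hr : r ∈ Icc p q) :
    polarPoint r t ∈ radialSegment t p q :=
  ⟨r, hr, rfl⟩

lemma mem_keyholeCurve {ε : ℝ} {w : ℂ} : w ∈ keyholeCurve ε ↔
    w ∈ circArc 1 ε (2 * Real.pi - ε) ∨ w ∈ circArc 2 ε (Real.pi - ε) ∨
    w ∈ circArc 2 (Real.pi + ε) (2 * Real.pi - ε) ∨ w ∈ circArc 3 (-Real.pi + ε) (Real.pi - ε) ∨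
    w ∈ radialSegment ε 1 2 ∨ w ∈ radialSegment (-ε) 1 2 ∨
    w ∈ radialSegment (Real.pi - ε) 2 3 ∨ w ∈ radialSegment (Real.pi + ε) 2 3 := by
  simp only [keyholeCurve, mem_union, or_assoc]

lemma keyHalf_mem_keyholeCurve {ε x : ℝ} (hε : 0 < ε) (hε' : ε ≤ 1 / 10)
    (hx : x ∈ Icc 0 (5 * Real.pi + 2 - 7 * ε)) :
    keyHalf ε x ∈ keyholeCurve ε ∧ starRingEnd ℂ (keyHalf ε x) ∈ keyholeCurve ε := by
  have hpi := Real.pi_gt_three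
  obtain ⟨hx0, hx1⟩ := hx
  simp only [mem_keyholeCurve, keyHalf, conj_polarPoint]
  rcases keyHalf_cases ε x with ⟨h1, h, h'⟩ | ⟨h1, h2, h, h'⟩ | ⟨h1, h2, h, h'⟩ | ⟨h1, h, h'⟩ <;>
    rw [h, h']
  · have h3 : x / 3 ∈ Icc (-Real.pi + ε) (Real.pi - ε) := by constructor <;> linarith
    have h4 : -(x / 3) ∈ Icc (-Real.pi + ε) (Real.pi - ε) := by constructor <;> linarith
    exact ⟨.inr (.inr (.inr (.inl (polarPoint_mem_circArc h3)))),
      .inr (.inr (.inr (.inl (polarPoint_mem_circArc h4))))⟩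
  · rw [← polarPoint_add_two_pi _ (-(Real.pi - ε)),
      show -(Real.pi - ε) + 2 * Real.pi = Real.pi + ε by ring]
    have h3 : 3 * Real.pi - 3 * ε + 3 - x ∈ Icc (2 : ℝ) 3 := by constructor <;> linarith
    exact ⟨.inr (.inr (.inr (.inr (.inr (.inr (.inl (polarPoint_mem_radialSegment h3))))))),
      .inr (.inr (.inr (.inr (.inr (.inr (.inr (polarPoint_mem_radialSegment h3)))))))⟩
  · rw [← polarPoint_add_two_pi _ (-_)]
    exact ⟨.inr (.inl (polarPoint_mem_circArc (by constructor <;> linarith))),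
      .inr (.inr (.inl (polarPoint_mem_circArc (by constructor <;> linarith))))⟩
  · have h3 : 5 * Real.pi - 7 * ε + 3 - x ∈ Icc (1 : ℝ) 2 := by constructor <;> linarith
    exact ⟨.inr (.inr (.inr (.inr (.inl (polarPoint_mem_radialSegment h3))))),
      .inr (.inr (.inr (.inr (.inr (.inl (polarPoint_mem_radialSegment h3))))))⟩

lemma keyHalf_mem_range {ε x : ℝ} (hε : 0 < ε) (hε' : ε ≤ 1 / 10)
    (hx : x ∈ Icc 0 (5 * Real.pi + 2 - 7 * ε)) :
    keyHalf ε x ∈ range (keyMap ε) ∧ starRingEnd ℂ (keyHalf ε x) ∈ range (keyMap ε) := by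
  have hv := keySpeed_ge hε hε'
  have hve := keySpeed_mul_self hε
  have h0 : 0 ≤ x / keySpeed ε := div_nonneg hx.1 (by linarith)
  have h1 : x / keySpeed ε ≤ ε := by
    rw [div_le_iff₀ (by linarith), mul_comm, hve]
    exact hx.2
  have h2 : keyArc ε (x / keySpeed ε) = keyHalf ε x := by
    rw [keyArc_of_nonneg h0]
    congr 1
    have : keySpeed ε ≠ 0 := by linarith
    field_simp
  refine ⟨⟨Circle.exp (x / keySpeed ε), ?_⟩, ⟨Circle.exp (-(x / keySpeed ε)), ?_⟩⟩
  · rw [keyMap_exp hε hε' ⟨by linarith, h1⟩, h2]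
  · rw [keyMap_exp hε hε' ⟨by linarith, by linarith⟩, keyArc_neg hε', h2]

lemma keyMap_eq_self {ε : ℝ} (hε : 0 < ε) (hε' : ε ≤ 1 / 10) {z : Circle}
    (hz : (z : ℂ) ∈ circArc 1 ε (2 * Real.pi - ε)) : keyMap ε z = z := by
  obtain ⟨t, ht, hzt⟩ := hz
  have : z = Circle.exp t := by
    ext
    rw [← hzt, ← polarPoint_one]
    rfl
  rw [this, keyMap_exp_of_mem hε hε' ht]

lemma coe_mem_circArc {ε : ℝ} (hε' : ε ≤ 1 / 10) {z : Circle} (hz : ε ≤ |Complex.arg z|) :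
    (z : ℂ) ∈ circArc 1 ε (2 * Real.pi - ε) := by
  have h1 := Complex.neg_pi_lt_arg (z : ℂ)
  have h2 := Complex.arg_le_pi (z : ℂ)
  have hpi := Real.pi_gt_three
  rw [← Circle.exp_arg z, ← polarPoint_one]
  rcases abs_cases (Complex.arg z) with ⟨h, _⟩ | ⟨h, h'⟩ <;> rw [h] at hz
  · exact polarPoint_mem_circArc ⟨hz, by linarith⟩
  · rw [← polarPoint_add_two_pi]
    exact polarPoint_mem_circArc ⟨by linarith, by linarith⟩

lemma range_keyMap {ε : ℝ} (hε : 0 < ε) (hε' : ε ≤ 1 / 10) :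
    range (keyMap ε) = keyholeCurve ε := by
  have hpi := Real.pi_gt_three
  apply Subset.antisymm
  · rintro _ ⟨z, rfl⟩
    rcases le_total ε |Complex.arg z| with h | h
    · rw [keyMap_of_le h]
      exact mem_keyholeCurve.2 (.inl (coe_mem_circArc hε' h))
    · rw [← Circle.exp_arg z, keyMap_exp hε hε' (abs_le.1 h)]
      rw [abs_le] at h
      rcases le_total 0 (Complex.arg z) with h0 | h0
      · rw [keyArc_of_nonneg h0]
        exact (keyHalf_mem_keyholeCurve hε hε' (keySpeed_mul_mem hε hε' ⟨h0, h.2⟩)).1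
      · have h1 := (keyHalf_mem_keyholeCurve hε hε'
          (keySpeed_mul_mem hε hε' (t := -Complex.arg z) ⟨by linarith, by linarith⟩)).2
        rwa [← keyArc_of_nonneg (by linarith), keyArc_neg hε', Complex.conj_conj] at h1
  · intro w hw
    have key := fun x h0 h1 => keyHalf_mem_range hε hε' (x := x) ⟨h0, h1⟩
    rcases mem_keyholeCurve.1 hw with ⟨t, ht, rfl⟩ | ⟨t, ht, rfl⟩ | ⟨t, ht, rfl⟩ | ⟨t, ht, rfl⟩ |
      ⟨t, ht, rfl⟩ | ⟨t, ht, rfl⟩ | ⟨t, ht, rfl⟩ | ⟨t, ht, rfl⟩ <;> obtain ⟨ht1, ht2⟩ := ht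
    · refine ⟨Circle.exp t, ?_⟩
      rw [keyMap_exp_of_mem hε hε' ⟨ht1, ht2⟩, ← polarPoint_one]
      rfl
    · have h := (key (5 * Real.pi - 5 * ε + 1 - 2 * t) (by linarith) (by linarith)).1
      rw [keyHalf_middle_arc (by linarith) (by linarith)] at h
      convert! h using 1
      change polarPoint 2 t = _
      congr 1
      ring
    · have h := (key (5 * Real.pi - 5 * ε + 1 - 2 * (2 * Real.pi - t)) (by linarith)
        (by linarith)).2
      rw [keyHalf_middle_arc (by linarith) (by linarith), conj_polarPoint,
        ← polarPoint_add_two_pi] at h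
      convert! h using 1
      change polarPoint 2 t = _
      congr 1
      ring
    · rcases le_total 0 t with h0 | h0
      · have h := (key (3 * t) (by linarith) (by linarith)).1
        rw [keyHalf_outer_arc (by linarith)] at h
        convert! h using 1
        change polarPoint 3 t = _
        congr 1
        ring
      · have h := (key (3 * -t) (by linarith) (by linarith)).2
        rw [keyHalf_outer_arc (by linarith), conj_polarPoint] at h
        convert! h using 1
        change polarPoint 3 t = _
        congr 1
        ring
    · have h := (key (5 * Real.pi - 7 * ε + 3 - t) (by linarith) (by linarith)).1
      rwa [keyHalf_inner_segment hε' (by linarith), sub_sub_cancel] at h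
    · have h := (key (5 * Real.pi - 7 * ε + 3 - t) (by linarith) (by linarith)).2
      rwa [keyHalf_inner_segment hε' (by linarith), sub_sub_cancel, conj_polarPoint] at h
    · have h := (key (3 * Real.pi - 3 * ε + 3 - t) (by linarith) (by linarith)).1
      rwa [keyHalf_outer_segment (by linarith) (by linarith), sub_sub_cancel] at h
    · have h := (key (3 * Real.pi - 3 * ε + 3 - t) (by linarith) (by linarith)).2
      rwa [keyHalf_outer_segment (by linarith) (by linarith), sub_sub_cancel, conj_polarPoint,
        ← polarPoint_add_two_pi,
        show -(Real.pi - ε) + 2 * Real.pi = Real.pi + ε by ring] at h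

lemma isEmbedding_keyMap {ε : ℝ} (hε : 0 < ε) (hε' : ε ≤ 1 / 10) : IsEmbedding (keyMap ε) := by
  have hanti : AntilipschitzWith 2 (keyMap ε) := by
    refine AntilipschitzWith.of_le_mul_dist fun a b => ?_
    have := half_dist_le_dist_keyMap hε hε' a b
    push_cast
    linarith
  have hlip : LipschitzWith (36 / ε).toNNReal (keyMap ε) := by
    refine LipschitzWith.of_dist_le_mul fun a b => ?_
    rw [Real.coe_toNNReal _ (by positivity)]
    exact dist_keyMap_le hε hε' a b
  exact (hanti.isUniformEmbedding hlip.uniformContinuous).isEmbedding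

lemma isKeyholeParam_keyMap {ε : ℝ} (hε : 0 < ε) (hε' : ε ≤ 1 / 10) :
    IsKeyholeParam ε (keyMap ε) where
  isEmbedding := isEmbedding_keyMap hε hε'
  range_eq := range_keyMap hε hε'
  eq_self _ hz := keyMap_eq_self hε hε' hz
  constantSpeed := by
    refine ⟨(keySpeed ε).toNNReal, fun x hx y hy => ?_⟩
    rw [← hasConstantSpeedOnWith_keyArc hε hε' hx hy]
    exact eVariationOn.congr fun t ht => keyMap_exp hε hε' ht.1

/-! ### The obstruction to extending the keyhole parametrization -/

/-- The open disc of radius `3` without the closed corridor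
`{r e^{is} : 2 ≤ r ≤ 3, |s - π| ≤ ε}`, written through the real and imaginary parts. -/
def slitDisc (ε : ℝ) : Set ℂ :=
  {w | ‖w‖ < 3 ∧ (‖w‖ < 2 ∨ -w.re * Real.sin ε < |w.im| * Real.cos ε)}

lemma isOpen_slitDisc (ε : ℝ) : IsOpen (slitDisc ε) := by
  have h : IsOpen {w : ℂ | -w.re * Real.sin ε < |w.im| * Real.cos ε} :=
    isOpen_lt (by fun_prop) (by fun_prop)
  exact (isOpen_lt continuous_norm continuous_const).inter
    ((isOpen_lt continuous_norm continuous_const).union h)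

lemma closure_slitDisc_subset (ε : ℝ) : closure (slitDisc ε) ⊆
    {w | ‖w‖ ≤ 3 ∧ (‖w‖ ≤ 2 ∨ -w.re * Real.sin ε ≤ |w.im| * Real.cos ε)} := by
  refine closure_minimal (fun w hw => ⟨hw.1.le, hw.2.imp le_of_lt le_of_lt⟩) ?_
  have h : IsClosed {w : ℂ | -w.re * Real.sin ε ≤ |w.im| * Real.cos ε} :=
    isClosed_le (by fun_prop) (by fun_prop)
  exact (isClosed_le continuous_norm continuous_const).inter
    ((isClosed_le continuous_norm continuous_const).union h)

lemma abs_im_sub_neg_re_polarPoint {r θ : ℝ} (hr : 0 ≤ r) (hθ : |θ| ≤ Real.pi) (ε : ℝ) :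
    |(polarPoint r θ).im| * Real.cos ε - -(polarPoint r θ).re * Real.sin ε =
      r * Real.sin (|θ| + ε) := by
  have h1 : 0 ≤ Real.sin |θ| := Real.sin_nonneg_of_nonneg_of_le_pi (abs_nonneg _) hθ
  have h2 : |Real.sin θ| = Real.sin |θ| := by
    rcases abs_cases θ with ⟨h, _⟩ | ⟨h, _⟩ <;> rw [h] at h1 ⊢
    · exact abs_of_nonneg h1
    · rw [← abs_neg, ← Real.sin_neg, abs_of_nonneg h1]
  simp only [polarPoint, Complex.re_ofReal_mul, Complex.im_ofReal_mul,
    Complex.exp_ofReal_mul_I_re, Complex.exp_ofReal_mul_I_im]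
  rw [abs_mul, abs_of_nonneg hr, h2, ← Real.cos_abs θ, Real.sin_add]
  ring

/-- The boundary of the slit disc is made of an arc, two segments of the keyhole curve, and
the short arc that closes the corridor on the inside. -/
lemma frontier_slitDisc_subset {ε : ℝ} (hε : 0 < ε) (hε' : ε ≤ 1 / 10) {w : ℂ}
    (hw : w ∈ frontier (slitDisc ε)) : 2 ≤ ‖w‖ ∧
      (w ∈ keyholeCurve ε ∨ ∃ s ∈ Icc (Real.pi - ε) (Real.pi + ε), w = polarPoint 2 s) := by
  rw [(isOpen_slitDisc ε).frontier_eq] at hw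
  obtain ⟨hw1, hw2⟩ := hw
  obtain ⟨hle, hcl⟩ := closure_slitDisc_subset ε hw1
  have hpi := Real.pi_gt_three
  obtain ⟨r, θ, hr, hθ, hθ', rfl⟩ :
      ∃ r θ : ℝ, 0 ≤ r ∧ -Real.pi < θ ∧ θ ≤ Real.pi ∧ w = polarPoint r θ :=
    ⟨‖w‖, Complex.arg w, norm_nonneg w, Complex.neg_pi_lt_arg w, Complex.arg_le_pi w,
      (Complex.norm_mul_exp_arg_mul_I w).symm⟩
  have habs : |θ| ≤ Real.pi := abs_le.2 ⟨hθ.le, hθ'⟩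
  have hform := abs_im_sub_neg_re_polarPoint hr habs ε
  simp only [slitDisc, mem_ofPred_eq, not_and, not_or, not_lt, norm_polarPoint hr] at hle hcl hw2 ⊢
  have hr2 : 2 ≤ r := by
    by_contra h
    exact h (hw2 (by linarith)).1
  refine ⟨hr2, ?_⟩
  -- the sign of the sine tells on which side of the corridor's walls the point lies
  have hneg : Real.pi - ε < |θ| → Real.sin (|θ| + ε) < 0 := fun h => by
    rw [← neg_pos, ← Real.sin_sub_pi]
    exact Real.sin_pos_of_pos_of_lt_pi (by linarith) (by linarith)
  have hpos : |θ| < Real.pi - ε → 0 < Real.sin (|θ| + ε) := fun h =>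
    Real.sin_pos_of_pos_of_lt_pi (by linarith [abs_nonneg θ]) (by linarith)
  have hneg' : 2 < r → |θ| ≤ Real.pi - ε := fun h => by
    by_contra! h1
    have h2 := hneg h1
    rcases hcl with h3 | h3 <;> nlinarith
  have hpos' : r < 3 → Real.pi - ε ≤ |θ| := fun h => by
    by_contra! h1
    have h2 := hpos h1
    nlinarith [(hw2 h).2]
  have hcases := abs_cases θ
  rw [mem_keyholeCurve]
  rcases hle.lt_or_eq with h3 | rfl
  · have h1 := hpos' h3
    rcases hr2.lt_or_eq with h2 | rfl
    · have h4 := le_antisymm (hneg' h2) h1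
      left
      rcases hcases with ⟨h, _⟩ | ⟨h, _⟩ <;> rw [h] at h4
      · rw [h4]
        exact .inr (.inr (.inr (.inr (.inr (.inr (.inl
          (polarPoint_mem_radialSegment ⟨h2.le, h3.le⟩)))))))
      · rw [← polarPoint_add_two_pi, show θ + 2 * Real.pi = Real.pi + ε by linarith]
        exact .inr (.inr (.inr (.inr (.inr (.inr (.inr
          (polarPoint_mem_radialSegment ⟨h2.le, h3.le⟩)))))))
    · right
      rcases hcases with ⟨h, _⟩ | ⟨h, _⟩ <;> rw [h] at h1
      · exact ⟨θ, ⟨by linarith, by linarith⟩, rfl⟩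
      · exact ⟨θ + 2 * Real.pi, ⟨by linarith, by linarith⟩, (polarPoint_add_two_pi _ _).symm⟩
  · left
    obtain ⟨h1, h2⟩ := abs_le.1 (hneg' (by norm_num))
    exact .inr (.inr (.inr (.inl (polarPoint_mem_circArc ⟨by linarith, by linarith⟩))))

/-- The image of every ray from the long arc of the unit circle to infinity leaves the
slit disc, and can do so only through the short arc that closes the corridor. -/
lemma exists_extension_eq_polarPoint_two {ε : ℝ} (hε : 0 < ε) (hε' : ε ≤ 1 / 10) {F : ℂ ≃ₜ ℂ}
    (hF : Extends F (keyMap ε)) {t : ℝ} (ht : t ∈ Icc ε (2 * Real.pi - ε)) :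
    ∃ r ≥ 1, ∃ s ∈ Icc (Real.pi - ε) (Real.pi + ε), F (polarPoint r t) = polarPoint 2 s := by
  have hstart : F (polarPoint 1 t) = polarPoint 1 t := by
    rw [polarPoint_one, hF, keyMap_exp_of_mem hε hε' ht]
  let c : ℝ → ℂ := fun r => F (polarPoint r t)
  have hc : Continuous c := F.continuous.comp (by unfold polarPoint; fun_prop)
  have hconn : IsPreconnected (c '' Ici 1) := isPreconnected_Ici.image c hc.continuousOn
  have hmeet : (c '' Ici 1 ∩ slitDisc ε).Nonempty := by
    refine ⟨c 1, ⟨1, self_mem_Ici, rfl⟩, ?_⟩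
    have h1 : ‖c 1‖ = 1 := by
      change ‖F (polarPoint 1 t)‖ = 1
      rw [hstart, norm_polarPoint zero_le_one]
    exact ⟨by linarith, Or.inl (by linarith)⟩
  have hleave : ¬ closure (slitDisc ε) ∩ c '' Ici 1 ⊆ slitDisc ε := by
    intro hsub
    have h1 := hconn.subset_of_closure_inter_subset (isOpen_slitDisc ε) hmeet hsub
    have hbdd : Bornology.IsBounded (F.symm '' Metric.closedBall (0 : ℂ) 3) :=
      ((isCompact_closedBall (0 : ℂ) 3).image F.symm.continuous).isBounded
    obtain ⟨R, hR⟩ := hbdd.exists_norm_le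
    have h2 := h1 ⟨max 1 (R + 1), mem_Ici.2 (le_max_left _ _), rfl⟩
    have h3 := hR _ ⟨c (max 1 (R + 1)), mem_closedBall_zero_iff.2 h2.1.le, rfl⟩
    rw [F.symm_apply_apply, norm_polarPoint (zero_le_one.trans (le_max_left _ _))] at h3
    linarith [le_max_right 1 (R + 1)]
  obtain ⟨w, ⟨hw1, r, hr, hrw⟩, hw2⟩ := not_subset.1 hleave
  have hfr : w ∈ frontier (slitDisc ε) := by
    rw [(isOpen_slitDisc ε).frontier_eq]
    exact ⟨hw1, hw2⟩
  obtain ⟨hnorm, hw | ⟨s, hs, hws⟩⟩ := frontier_slitDisc_subset hε hε' hfr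
  · exfalso
    rw [← range_keyMap hε hε'] at hw
    obtain ⟨z, hz⟩ := hw
    have h1 : polarPoint r t = z := F.injective (by rw [hF, hz, ← hrw])
    have h2 : r = 1 := by
      rw [← norm_polarPoint (zero_le_one.trans hr) t, h1, Circle.norm_coe]
    have h3 : w = polarPoint 1 t := by
      rw [← hrw, h2]; exact hstart
    rw [h3, norm_polarPoint zero_le_one] at hnorm
    linarith
  · exact ⟨r, hr, s, hs, hrw.trans hws⟩

/-- The inverse of an extension maps an arc of length `4ε` onto a set whose
radial projection covers an arc of length `2π - 2ε`. -/
lemma le_lipConst_symm_of_extends {ε : ℝ} (hε : 0 < ε) (hε' : ε ≤ 1 / 10) {F : ℂ ≃ₜ ℂ}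
    (hF : Extends F (keyMap ε)) :
    ENNReal.ofReal ((2 * Real.pi - 2 * ε) / (4 * ε)) ≤ lipConst F.symm := by
  have hpi := Real.pi_gt_three
  rcases eq_or_ne (lipConst F.symm) ⊤ with htop | htop
  · rw [htop]; exact le_top
  set K := (lipConst F.symm).toReal
  have hKe : lipConst F.symm = ENNReal.ofReal K := (ENNReal.ofReal_toReal htop).symm
  have hK : 0 ≤ K := ENNReal.toReal_nonneg
  have hlip := dist_le_of_lipConst_le hK hKe.le
  rw [hKe]
  refine ENNReal.ofReal_le_ofReal ?_
  rw [div_le_iff₀ (by positivity)]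
  set A := 2 * Real.pi - 2 * ε with hA
  choose! r hr s hs hrs using fun t (ht : t ∈ Icc ε (2 * Real.pi - ε)) =>
    exists_extension_eq_polarPoint_two hε hε' hF ht
  have hdist : ∀ t ∈ Icc ε (2 * Real.pi - ε), ∀ t' ∈ Icc ε (2 * Real.pi - ε),
      dist (Circle.exp t) (Circle.exp t') ≤ |2 * K * s t - 2 * K * s t'| := by
    intro t ht t' ht'
    have h1 := dist_exp_le_dist_polarPoint (hr t ht) (hr t' ht') t t'
    have h2 := hlip (polarPoint 2 (s t)) (polarPoint 2 (s t'))
    rw [← hrs t ht, ← hrs t' ht', F.symm_apply_apply, F.symm_apply_apply, hrs t ht, hrs t' ht',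
      dist_polarPoint_same_radius zero_le_two] at h2
    have h3 := Real.abs_sin_le_abs (x := (s t - s t') / 2)
    rw [abs_div, abs_two] at h3
    rw [← mul_sub, abs_mul, abs_of_nonneg (by positivity)]
    nlinarith
  have hphi : HasDerivAt (fun d => 2 * Real.sin (d / 2)) 1 0 := by
    have h0 : HasDerivAt (fun d : ℝ => d / 2) (1 / 2) 0 := (hasDerivAt_id (0 : ℝ)).div_const 2
    convert! h0.sin.const_mul 2 using 1
    simp
  have hlim := tendsto_add_one_mul_comp_div hphi (by simp) A
  rw [one_mul] at hlim
  have hsmall : ∀ᶠ n : ℕ in Filter.atTop, A / ((n : ℝ) + 1) ≤ 2 * ε := by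
    have h1 : Filter.Tendsto (fun n : ℕ => A * (1 / ((n : ℝ) + 1))) Filter.atTop (𝓝 (A * 0)) :=
      tendsto_one_div_add_atTop_nhds_zero_nat.const_mul A
    rw [mul_zero] at h1
    filter_upwards [h1.eventually_lt_const (by positivity : (0 : ℝ) < 2 * ε)] with n hn
    rw [mul_one_div] at hn
    exact hn.le
  refine le_of_tendsto hlim ?_
  filter_upwards [hsmall] with n hn
  -- `n + 2` equally spaced points of the long arc, with gap `δ`
  have hn0 : (0 : ℝ) < (n : ℝ) + 1 := by positivity
  set δ := A / ((n : ℝ) + 1) with hδ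
  have hδn : ((n : ℝ) + 1) * δ = A := by rw [hδ]; field_simp
  have hδ0 : 0 < δ := div_pos (by linarith) hn0
  let τ : ℕ → ℝ := fun j => ε + j * δ
  have hτ : ∀ j ∈ Finset.range (n + 2), τ j ∈ Icc ε (2 * Real.pi - ε) := by
    intro j hj
    have h1 : (j : ℝ) ≤ n + 1 := by exact_mod_cast Nat.lt_succ_iff.1 (Finset.mem_range.1 hj)
    have h2 := mul_le_mul_of_nonneg_right h1 hδ0.le
    have h3 : 0 ≤ (j : ℝ) * δ := by positivity
    constructor <;> simp only [τ] <;> linarith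
  have hsep : ∀ i ∈ Finset.range (n + 2), ∀ j ∈ Finset.range (n + 2), i ≠ j →
      2 * Real.sin (δ / 2) ≤ |2 * K * s (τ i) - 2 * K * s (τ j)| := by
    intro i hi j hj hij
    refine le_trans ?_ (hdist _ (hτ i hi) _ (hτ j hj))
    refine two_mul_sin_le_dist_exp hδ0.le ?_ ?_
    · have h1 : τ i - τ j = ((i : ℝ) - j) * δ := by simp only [τ]; ring
      have h2 : (1 : ℝ) ≤ |(i : ℝ) - j| := by
        have : (1 : ℤ) ≤ |(i : ℤ) - j| := Int.one_le_abs (by omega)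
        exact_mod_cast this
      rw [h1, abs_mul, abs_of_pos hδ0]
      nlinarith
    · obtain ⟨h1, h2⟩ := hτ i hi
      obtain ⟨h3, h4⟩ := hτ j hj
      rw [abs_le]
      constructor <;> linarith
  have hsin : 0 < Real.sin (δ / 2) :=
    Real.sin_pos_of_pos_of_lt_pi (by linarith) (by linarith)
  have hinj : Set.InjOn (fun j => 2 * K * s (τ j)) (Finset.range (n + 2)) := by
    intro i hi j hj hij
    by_contra hne
    have h1 := hsep i hi j hj hne
    have h2 : 2 * K * s (τ i) - 2 * K * s (τ j) = 0 := sub_eq_zero.2 hij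
    rw [h2, abs_zero] at h1
    linarith
  have hpack := card_sub_one_mul_le_of_pairwise (d := 2 * Real.sin (δ / 2))
    (a := 2 * K * (Real.pi - ε)) (b := 2 * K * (Real.pi + ε))
    ((Finset.range (n + 2)).image fun j => 2 * K * s (τ j))
    (Finset.Nonempty.image ⟨0, by simp⟩ _)
    (by
      intro x hx
      obtain ⟨j, hj, rfl⟩ := Finset.mem_image.1 hx
      have h1 := hs _ (hτ j hj)
      exact ⟨mul_le_mul_of_nonneg_left h1.1 (by positivity),
        mul_le_mul_of_nonneg_left h1.2 (by positivity)⟩)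
    (by
      intro x hx y hy hxy
      obtain ⟨i, hi, rfl⟩ := Finset.mem_image.1 hx
      obtain ⟨j, hj, rfl⟩ := Finset.mem_image.1 hy
      exact hsep i hi j hj fun h => hxy (by rw [h]))
  rw [Finset.card_image_of_injOn hinj, Finset.card_range] at hpack
  push_cast at hpack
  linarith

/-! ### Bounds for lower factors -/

lemma lipConst_keyMap_symm_le {ε : ℝ} (hε : 0 < ε) (hε' : ε ≤ 1 / 10)
    (hf : IsEmbedding (keyMap ε)) : lipConst hf.toHomeomorph.symm ≤ 2 := by
  rw [← ENNReal.ofReal_ofNat 2]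
  refine lipConst_le_ofReal fun p q => ?_
  obtain ⟨a, rfl⟩ := hf.toHomeomorph.surjective p
  obtain ⟨b, rfl⟩ := hf.toHomeomorph.surjective q
  rw [Homeomorph.symm_apply_apply, Homeomorph.symm_apply_apply]
  have h : dist (hf.toHomeomorph a) (hf.toHomeomorph b) = dist (keyMap ε a) (keyMap ε b) := rfl
  have := half_dist_le_dist_keyMap hε hε' a b
  rw [h]
  linarith

lemma one_le_lipConst_keyMap_symm {ε : ℝ} (hε : 0 < ε) (hε' : ε ≤ 1 / 10)
    (hf : IsEmbedding (keyMap ε)) : 1 ≤ lipConst hf.toHomeomorph.symm := by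
  have hpi := Real.pi_gt_three
  rw [← ENNReal.ofReal_one]
  have h1 := keyMap_exp_of_mem hε hε' (t := ε) ⟨le_rfl, by linarith⟩
  have h2 := keyMap_exp_of_mem hε hε' (t := Real.pi) ⟨by linarith, by linarith⟩
  have hne : Circle.exp ε ≠ Circle.exp Real.pi := fun h =>
    absurd (Circle.exp_injOn_Icc (a := ε) (b := Real.pi) (by linarith)
      (left_mem_Icc.2 (by linarith)) (right_mem_Icc.2 (by linarith)) h) (by linarith)
  refine ofReal_le_lipConst (hf.toHomeomorph.injective.ne hne) ?_
  rw [Homeomorph.symm_apply_apply, Homeomorph.symm_apply_apply, one_mul]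
  change dist (keyMap ε _) (keyMap ε _) ≤ _
  rw [h1, h2]
  rfl

/-- The point `1` is mapped to `3`, while `e^{iε}` is fixed. -/
lemma two_div_le_lipConst_keyMap {ε : ℝ} (hε : 0 < ε) (hε' : ε ≤ 1 / 10) :
    ENNReal.ofReal (2 / ε) ≤ lipConst (keyMap ε) := by
  have hpi := Real.pi_gt_three
  have h0 := keyMap_exp hε hε' (t := 0) ⟨by linarith, hε.le⟩
  have h1 := keyMap_exp hε hε' (t := ε) ⟨by linarith, le_rfl⟩
  rw [keyArc_zero hε'] at h0
  rw [keyArc_self hε hε'] at h1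
  have hne : Circle.exp 0 ≠ Circle.exp ε := fun h =>
    absurd (Circle.exp_injOn_Icc (a := 0) (b := ε) (by linarith)
      (left_mem_Icc.2 hε.le) (right_mem_Icc.2 hε.le) h) (by linarith)
  refine ofReal_le_lipConst hne ?_
  rw [h0, h1]
  have h2 := dist_exp_le 0 ε
  rw [zero_sub, abs_neg, abs_of_pos hε] at h2
  have h3 : (2 : ℝ) ≤ dist (3 : ℂ) (Circle.exp ε) := by
    have h4 := norm_sub_norm_le (3 : ℂ) (Circle.exp ε)
    rw [Circle.norm_coe, Complex.norm_ofNat] at h4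
    rw [dist_eq_norm]
    linarith
  calc 2 / ε * dist (Circle.exp 0) (Circle.exp ε) ≤ 2 / ε * ε := by gcongr
    _ = 2 := by field_simp
    _ ≤ _ := h3

/-- The multiple of the inclusion of the circle shows that a lower factor is at most `l`. -/
lemma IsLowerFactor.le_left {l L m : ℝ} (hl : 0 < l) (hlL : l ≤ L) (h : IsLowerFactor l L m) :
    m ≤ l := by
  have hd : ∀ a b : Circle, dist ((l : ℂ) * a) ((l : ℂ) * b) = l * dist a b := by
    intro a b
    rw [dist_eq_norm, ← mul_sub, norm_mul, Complex.norm_real, Real.norm_of_nonneg hl.le,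
      ← dist_eq_norm]
    rfl
  have hemb : IsEmbedding fun a : Circle => (l : ℂ) * a :=
    (Homeomorph.mulLeft₀ (l : ℂ) (by exact_mod_cast hl.ne')).isEmbedding.comp
      IsEmbedding.subtypeVal
  obtain ⟨F, hF, hm⟩ := h (fun a => (l : ℂ) * a) hemb fun a b => by
    rw [hd]
    exact ⟨le_rfl, mul_le_mul_of_nonneg_right hlL dist_nonneg⟩
  have h1 := hm (1 : Circle) (-1 : Circle)
  rw [hF, hF, hd] at h1
  have h2 : dist ((1 : Circle) : ℂ) ((-1 : Circle) : ℂ) = dist (1 : Circle) (-1) := rfl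
  rw [h2] at h1
  exact le_of_mul_le_mul_right h1 (dist_pos.2 (Circle.neg_ne_self 1).symm)

/-- A multiple of a keyhole parametrization, with an opening adapted to `l / L`, bounds the lower
factor when `l / L` is small; otherwise the bound by `l` suffices. -/
lemma IsLowerFactor.le_mul_sq_div {l L m : ℝ} (hl : 0 < l) (hlL : l ≤ L) (h : IsLowerFactor l L m) :
    m ≤ 720 * (l ^ 2 / L) := by
  have hpi := Real.pi_gt_three
  have hL : 0 < L := hl.trans_le hlL
  rcases le_or_gt m 0 with hm0 | hm0
  · exact hm0.trans (by positivity)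
  -- with this opening, `2l` times the keyhole parametrization is `L`-Lipschitz
  set ε := 72 * l / L with hεdef
  have hε : 0 < ε := by positivity
  rcases le_or_gt ε (1 / 10) with hε' | hε'
  · have hl2 : (0 : ℝ) < 2 * l := by positivity
    have hne : ((2 * l : ℝ) : ℂ) ≠ 0 := by exact_mod_cast hl2.ne'
    let M : ℂ ≃ₜ ℂ := Homeomorph.mulLeft₀ ((2 * l : ℝ) : ℂ) hne
    have hM : ∀ w, M w = ((2 * l : ℝ) : ℂ) * w := fun w => rfl
    have hd : ∀ w w', dist (M w) (M w') = 2 * l * dist w w' := by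
      intro w w'
      rw [hM, hM, dist_eq_norm, ← mul_sub, norm_mul, Complex.norm_real,
        Real.norm_of_nonneg hl2.le, ← dist_eq_norm]
    obtain ⟨F, hF, hm⟩ := h (fun a => M (keyMap ε a))
      (M.isEmbedding.comp (isEmbedding_keyMap hε hε')) fun a b => by
        have h1 := half_dist_le_dist_keyMap hε hε' a b
        have h2 := dist_keyMap_le hε hε' a b
        rw [hd]
        constructor
        · nlinarith
        · calc 2 * l * dist (keyMap ε a) (keyMap ε b) ≤ 2 * l * (36 / ε * dist a b) := by gcongr
            _ = L * dist a b := by rw [hεdef]; field_simp; norm_num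
    let G : ℂ ≃ₜ ℂ := F.trans M.symm
    have hG : Extends G (keyMap ε) := fun z => by
      change M.symm (F z) = _
      rw [hF, M.symm_apply_apply]
    have h1 := le_lipConst_symm_of_extends hε hε' hG
    have h2 : lipConst G.symm ≤ ENNReal.ofReal (2 * l / m) := by
      refine lipConst_le_ofReal fun p q => ?_
      have h3 := hm (G.symm p) (G.symm q)
      have h4 : ∀ w, F (G.symm w) = M w := fun w => F.apply_symm_apply _
      rw [h4, h4, hd] at h3
      rw [div_mul_eq_mul_div, le_div_iff₀ hm0]
      linarith
    have h3 := h1.trans h2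
    rw [ENNReal.ofReal_le_ofReal_iff (by positivity), div_le_div_iff₀ (by positivity) hm0] at h3
    have h4 : m ≤ 2 * l * ε := by nlinarith
    have h5 : 2 * l * ε = 144 * (l ^ 2 / L) := by rw [hεdef]; ring
    have h6 : 0 ≤ l ^ 2 / L := by positivity
    linarith
  · refine (h.le_left hl hlL).trans ?_
    rw [hεdef, lt_div_iff₀ hL] at hε'
    rw [← mul_div_assoc, le_div_iff₀ hL]
    nlinarith

theorem mainTheorem4 :
    -- the keyhole maps
    (∃ ε₀ c C : ℝ, 0 < ε₀ ∧ 0 < c ∧ 0 < C ∧ ∀ ε : ℝ, 0 < ε → ε < ε₀ →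
      ∃ (f : Circle → ℂ) (hf : IsKeyholeParam ε f),
        lipConst hf.isEmbedding.toHomeomorph.symm ≤ 2 ∧
        ENNReal.ofReal (c / ε) ≤ lipConst f ∧ lipConst f ≤ ENNReal.ofReal (C / ε) ∧
        -- `L / ℓ²` is of order `1 / ε`, where `L = Lip(f)` and `ℓ = 1 / Lip(f⁻¹)`
        ENNReal.ofReal (c / ε) ≤ lipConst f * lipConst hf.isEmbedding.toHomeomorph.symm ^ 2 ∧
        lipConst f * lipConst hf.isEmbedding.toHomeomorph.symm ^ 2 ≤ ENNReal.ofReal (C / ε) ∧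
        ∀ F : ℂ ≃ₜ ℂ, Extends F f →
          ENNReal.ofReal ((2 * Real.pi - 2 * ε) / (4 * ε)) ≤ lipConst F.symm ∧
          ENNReal.ofReal c * (lipConst f * lipConst hf.isEmbedding.toHomeomorph.symm ^ 2)
            ≤ lipConst F.symm) ∧
    -- no positive lower factor can depend on `ℓ` alone
    (∀ l : ℝ, 0 < l → ∀ m : ℝ, 0 < m → ∃ L : ℝ, l ≤ L ∧ ¬ IsLowerFactor l L m) ∧
    -- every admissible lower factor is at most a constant times `ℓ² / L`
    (∃ K : ℝ, 0 < K ∧ ∀ l L m : ℝ, 0 < l → l ≤ L → IsLowerFactor l L m → m ≤ K * (l ^ 2 / L)) := by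
  have hpi := Real.pi_gt_three
  refine ⟨⟨1 / 10, 1 / 100, 144, by norm_num, by norm_num, by norm_num, fun ε hε hε₀ => ?_⟩, ?_,
    720, by norm_num, fun l L m hl hlL h => h.le_mul_sq_div hl hlL⟩
  · have hε' := hε₀.le
    have hf := isKeyholeParam_keyMap hε hε'
    refine ⟨keyMap ε, hf, ?_⟩
    have hsymm := lipConst_keyMap_symm_le hε hε' hf.isEmbedding
    have hsymm1 := one_le_lipConst_keyMap_symm hε hε' hf.isEmbedding
    have hlow := two_div_le_lipConst_keyMap hε hε'
    have hup : lipConst (keyMap ε) ≤ ENNReal.ofReal (36 / ε) :=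
      lipConst_le_ofReal (dist_keyMap_le hε hε')
    generalize lipConst hf.isEmbedding.toHomeomorph.symm = S at *
    have hlow' : ENNReal.ofReal (1 / 100 / ε) ≤ lipConst (keyMap ε) := by
      refine le_trans (ENNReal.ofReal_le_ofReal ?_) hlow
      gcongr
      norm_num
    have hprod : lipConst (keyMap ε) * S ^ 2 ≤ ENNReal.ofReal (144 / ε) := by
      calc lipConst (keyMap ε) * S ^ 2 ≤ ENNReal.ofReal (36 / ε) * 2 ^ 2 := by gcongr
        _ = ENNReal.ofReal (36 / ε) * ENNReal.ofReal 4 := by norm_num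
        _ = ENNReal.ofReal (144 / ε) := by
          rw [← ENNReal.ofReal_mul (by positivity)]
          congr 1
          ring
    refine ⟨hsymm, hlow', hup.trans (ENNReal.ofReal_le_ofReal (by gcongr; norm_num)), ?_, hprod,
      fun F hF => ?_⟩
    · exact hlow'.trans (le_mul_of_one_le_right (zero_le) (one_le_pow₀ hsymm1))
    · have hF' := le_lipConst_symm_of_extends hε hε' hF
      refine ⟨hF', le_trans ?_ hF'⟩
      calc ENNReal.ofReal (1 / 100) * (lipConst (keyMap ε) * S ^ 2)
          ≤ ENNReal.ofReal (1 / 100) * ENNReal.ofReal (144 / ε) := by gcongr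
        _ = ENNReal.ofReal (1 / 100 * (144 / ε)) := (ENNReal.ofReal_mul (by norm_num)).symm
        _ ≤ _ := by
          refine ENNReal.ofReal_le_ofReal ?_
          rw [← mul_div_assoc, div_le_div_iff₀ hε (by positivity)]
          nlinarith
  · intro l hl m hm
    refine ⟨max l (1440 * l ^ 2 / m), le_max_left _ _, fun h => ?_⟩
    have hL : 0 < max l (1440 * l ^ 2 / m) := hl.trans_le (le_max_left _ _)
    have h1 := h.le_mul_sq_div hl (le_max_left _ _)
    have h2 := (div_le_iff₀ hm).1 (le_max_right l (1440 * l ^ 2 / m))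
    rw [← mul_div_assoc, le_div_iff₀ hL] at h1
    nlinarith [sq_pos_of_pos hl]
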